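/- Let $m\ge 2$, let $(E,\mathcal E)$ be a measurable space, let $Q$ be a probability kernel on $(E^m,\mathcal E^{\otimes m})$ which is symmetric, i.e. $Q(x_1,\dots,x_m;C_1\times\cdots\times C_m)=Q(x_{\sigma(1)},\dots,x_{\sigma(m)};C_{\sigma(1)}\times\cdots\times C_{\sigma(m)})$ for all permutations $\sigma$ and all $C_i\in\mathcal E$, let $\mu$ be a probability measure on $(E,\mathcal E)$ and let $\lambda,t\ge 0$. *Agents.* For $N\ge m$, consider $N$ agents whose initial states are independent with law $\mu$. At each jump of an independent Poisson process of intensity $\lambda N/m$, a group of $m$ agents, chosen uniformly among the $\binom Nm$ groups and independently of the past, interacts: the states $(x_1,\dots,x_m)$ of its members are replaced by a sample of $Q(x_1,\dots,x_m;\cdot)$. Let $\mu_t^{*,N}$ be the law at time $t$ of the state of a tagged agent. *Extended Wild sum.* For probability measures $\nu_1,\dots,\nu_m$ on $E$ let $(\nu_1,\dots,\nu_m)^{\circ_m}(C)=\int \nu_1(dx_1)\cdots\nu_m(dx_m)\,Q(x_1,\dots,x_m;C\times E^{m-1})$. For an ordered $m$-ary tree $A$ define $\mu^{\circ_m A}=\mu$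 if $A$ is a single leaf, and $\mu^{\circ_m A}=(\mu^{\circ_m A^1},\dots,\mu^{\circ_m A^m})^{\circ_m}$ if $A$ has a root branching with subtrees $A^1,\dots,A^m$. Let $\mathbb A_n$ be the family of ordered $m$-ary trees with $n$ internal nodes, the order in which the nodes branch being taken into account (a tree is counted once for each order in which its nodes can be added successively, each one in place of a leaf), so that $\mathbb A_n$ has $\#_m(n)=\prod_{k=1}^{n-1}((m-1)k+1)$ members. Put $$p_n(t)=\frac{\#_m(n)}{(m-1)^n\,n!}\,e^{-\lambda t}\bigl(1-e^{-(m-1)\lambda t}\bigr)^n,\qquad \mu_t=\sum_{n\ge 0}p_n(t)\,\frac1{\#_m(n)}\sum_{A\in\mathbb A_n}\mu^{\circ_m A}.$$ *Claim.* As $N\to\infty$, $\mu_t^{*,N}(C)\to\mu_t(C)$ for every $C\in\mathcal E$, whichever agent is tagged for each $N$. The same holds for the law obtained from the tagged agent's history after removal of the redundant (cycle-creating) interactions: if $p_{N,n}(t)$ is the probability that a pure birth process started at $0$ with birth intensities $$\lambda_{N,n}=\lambda\,\frac Nm\,((m-1)n+1)\binom{N-((m-1)n+1)}{m-1}\binom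 Nm^{-1}$$ (read as $0$ if $N<(m-1)n+1$) has had exactly $n$ births up to time $t$, then $$\sum_{n\ge0}p_{N,n}(t)\,\frac1{\#_m(n)}\sum_{A\in\mathbb A_n}\mu^{\circ_m A}(C)\longrightarrow\mu_t(C)\quad\text{as } N\to\infty,\ \text{for every } C\in\mathcal E.$$ -/

import Mathlib

open MeasureTheory ProbabilityTheory Filter Topology
open scoped NNReal ENNReal

namespace ExtendedWild

/-! ### Ordered `m`-ary trees -/

/-- Ordered `m`-ary trees: a leaf, or an internal node with an ordered family of `m` subtrees. -/
inductive MTree (m : ℕ) : Type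
  | leaf : MTree m
  | node (children : Fin m → MTree m) : MTree m

namespace MTree

/-- The number of leaves. -/
def numLeaves {m : ℕ} : MTree m → ℕ
  | leaf => 1
  | node c => ∑ i, numLeaves (c i)

/-- The trees obtained from a given tree by putting an internal node (with `m` new leaves) in the
place of one of its leaves, one entry for each leaf. -/
def grow {m : ℕ} : MTree m → Multiset (MTree m)
  | leaf => {node fun _ => leaf}
  | node c => ∑ i, (grow (c i)).map fun T => node (Function.update c i T)

end MTree

/-- The family `𝔸_n` of `m`-ary ordered trees with `n` internal nodes, the order in which the nodes
branch being taken into account: a tree occurs once for each order in which its internal nodes can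
be added successively, starting from the single leaf. -/
def trees (m : ℕ) : ℕ → Multiset (MTree m)
  | 0 => {MTree.leaf}
  | n + 1 => (trees m n).bind MTree.grow

/-- `#_m(n) = ∏_{k=1}^{n-1} ((m-1)k+1)`. -/
def numTrees (m n : ℕ) : ℕ := ∏ k ∈ Finset.Ico 1 n, ((m - 1) * k + 1)

theorem MTree.card_grow {m : ℕ} (T : MTree m) : T.grow.card = T.numLeaves := by
  induction T with
  | leaf => simp [MTree.grow, MTree.numLeaves]
  | node c ih => simp [MTree.grow, MTree.numLeaves, ih]

theorem MTree.numLeaves_of_mem_grow {m : ℕ} (hm : 1 ≤ m) (T : MTree m) :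
    ∀ S ∈ T.grow, S.numLeaves = T.numLeaves + (m - 1) := by
  induction T with
  | leaf =>
    intro S hS
    simp only [MTree.grow, Multiset.mem_singleton] at hS
    subst hS
    simp [MTree.numLeaves]
    omega
  | node c ih =>
    intro S hS
    simp only [MTree.grow, Multiset.mem_sum, Finset.mem_univ, true_and, Multiset.mem_map] at hS
    obtain ⟨i, T, hT, rfl⟩ := hS
    have h := ih i T hT
    simp only [MTree.numLeaves]
    rw [← Finset.add_sum_erase _ _ (Finset.mem_univ i),
      ← Finset.add_sum_erase _ (fun j => (c j).numLeaves) (Finset.mem_univ i)]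
    have h2 : ∑ j ∈ Finset.univ.erase i, (Function.update c i T j).numLeaves
        = ∑ j ∈ Finset.univ.erase i, (c j).numLeaves := by
      refine Finset.sum_congr rfl fun j hj => ?_
      rw [Function.update_of_ne (Finset.ne_of_mem_erase hj)]
    rw [h2, Function.update_self, h]
    omega

theorem numLeaves_of_mem_trees {m : ℕ} (hm : 1 ≤ m) (n : ℕ) :
    ∀ T ∈ trees m n, T.numLeaves = (m - 1) * n + 1 := by
  induction n with
  | zero => simp [trees, MTree.numLeaves]
  | succ n ih =>
    intro S hS
    obtain ⟨T, hT, hS⟩ := Multiset.mem_bind.1 hS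
    rw [MTree.numLeaves_of_mem_grow hm T S hS, ih T hT]
    ring

/-- The family `𝔸_n` has `#_m(n)` members. -/
theorem card_trees {m : ℕ} (hm : 1 ≤ m) (n : ℕ) : (trees m n).card = numTrees m n := by
  induction n with
  | zero => simp [trees, numTrees]
  | succ n ih =>
    have h : (trees m n).map (Multiset.card ∘ MTree.grow)
        = (trees m n).map fun _ => (m - 1) * n + 1 := by
      refine Multiset.map_congr rfl fun T hT => ?_
      simp [MTree.card_grow, numLeaves_of_mem_trees hm n T hT]
    rw [trees, Multiset.card_bind, h]
    rcases Nat.eq_zero_or_pos n with rfl | hn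
    · simp [trees, numTrees]
    · rw [Multiset.map_const', Multiset.sum_replicate, ih, numTrees, numTrees,
        Finset.prod_Ico_succ_top hn, smul_eq_mul]

noncomputable section

variable {E : Type*} [MeasurableSpace E] {m : ℕ}

/-! ### The interaction kernel and the laws along trees -/

/-- Symmetry of the kernel `Q`:
`Q(x_1,…,x_m; C_1×⋯×C_m) = Q(x_{σ(1)},…,x_{σ(m)}; C_{σ(1)}×⋯×C_{σ(m)})`. -/
def IsSymmetricKernel (Q : Kernel (Fin m → E) (Fin m → E)) : Prop :=
  ∀ (σ : Equiv.Perm (Fin m)) (x : Fin m → E) (C : Fin m → Set E), (∀ i, MeasurableSet (C i)) →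
    Q x (Set.univ.pi C) = Q (fun i => x (σ i)) (Set.univ.pi fun i => C (σ i))

/-- The law of the first component after the interaction of `m` independent components with
laws `ν_1,…,ν_m`, i.e. `C ↦ ∫ ν_1(dx_1)⋯ν_m(dx_m) Q(x_1,…,x_m; C × E^{m-1})`. -/
def interactionLaw [NeZero m] (Q : Kernel (Fin m → E) (Fin m → E)) (ν : Fin m → Measure E) :
    Measure E :=
  ((Measure.pi ν).bind Q).map fun y => y 0

/-- `μ^{∘_m A}`: the law at the root of the tree `A` when `μ` is placed on each leaf and the
interaction is performed at each internal node. -/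
def treeLaw [NeZero m] (Q : Kernel (Fin m → E) (Fin m → E)) (μ : Measure E) :
    MTree m → Measure E
  | .leaf => μ
  | .node c => interactionLaw Q fun i => treeLaw Q μ (c i)

/-- `(1/#_m(n)) Σ_{A ∈ 𝔸_n} μ^{∘_m A}`. -/
def meanTreeLaw [NeZero m] (Q : Kernel (Fin m → E) (Fin m → E)) (μ : Measure E) (n : ℕ) :
    Measure E :=
  (numTrees m n : ℝ≥0∞)⁻¹ • ((trees m n).map (treeLaw Q μ)).sum

/-- `Σ_n p_n (1/#_m(n)) Σ_{A ∈ 𝔸_n} μ^{∘_m A}`. -/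
def treeMixture [NeZero m] (Q : Kernel (Fin m → E) (Fin m → E)) (μ : Measure E) (p : ℕ → ℝ) :
    Measure E :=
  Measure.sum fun n => ENNReal.ofReal (p n) • meanTreeLaw Q μ n

/-- `p_n(t) = #_m(n) / ((m-1)^n n!) e^{-λt} (1 - e^{-(m-1)λt})^n`. -/
def branchingProb (m : ℕ) (lam t : ℝ) (n : ℕ) : ℝ :=
  numTrees m n / (((m : ℝ) - 1) ^ n * n.factorial) * Real.exp (-(lam * t))
    * (1 - Real.exp (-(((m : ℝ) - 1) * lam * t))) ^ n

/-- The extended Wild sum `μ_t = Σ_n p_n(t) (1/#_m(n)) Σ_{A ∈ 𝔸_n} μ^{∘_m A}`. -/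
def extendedWildSum [NeZero m] (Q : Kernel (Fin m → E) (Fin m → E)) (μ : Measure E)
    (lam t : ℝ≥0) : Measure E :=
  treeMixture Q μ (branchingProb m lam t)

/-! ### The system of `N` interacting agents -/

/-- The groups of `m` agents among `N`. -/
abbrev AgentGroup (N m : ℕ) : Type := {G : Finset (Fin N) // G.card = m}

/-- The members of a group, listed in increasing order. -/
def AgentGroup.member {N : ℕ} (G : AgentGroup N m) : Fin m → Fin N := G.1.orderEmbOfFin G.2

/-- The configuration `x` in which the states of the members of `G` are replaced by `y`. -/
def AgentGroup.replace {N : ℕ} (G : AgentGroup N m) (x : Fin N → E) (y : Fin m → E) : Fin N → E :=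
  Function.extend G.member y x

theorem AgentGroup.measurable_states {N : ℕ} (G : AgentGroup N m) :
    Measurable fun (x : Fin N → E) (i : Fin m) => x (G.member i) := by
  fun_prop

theorem AgentGroup.measurable_replace {N : ℕ} (G : AgentGroup N m) :
    Measurable fun p : (Fin N → E) × (Fin m → E) => G.replace p.1 p.2 := by
  refine measurable_pi_lambda _ fun j => ?_
  by_cases h : ∃ i, G.member i = j
  · obtain ⟨i, rfl⟩ := h
    have hinj : Function.Injective G.member := (G.1.orderEmbOfFin G.2).injective
    simp only [AgentGroup.replace, hinj.extend_apply]
    fun_prop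
  · simp only [AgentGroup.replace, Function.extend_apply' _ _ _ h]
    fun_prop

/-- One interaction of the group `G`: from the configuration `x`, the states of the members of
`G` are replaced by a sample from `Q` at their present states; the other agents do not move. -/
def groupKernel {N : ℕ} (Q : Kernel (Fin m → E) (Fin m → E)) (G : AgentGroup N m) :
    Kernel (Fin N → E) (Fin N → E) :=
  (Kernel.id ×ₖ Q.comap _ G.measurable_states).map fun p => G.replace p.1 p.2

/-- One step of the Kac walk, acting on the laws of configurations: each of the `binom N m` groups
is equally likely to interact. (For `N < m` there are no groups; the value is then irrelevant.) -/
def kacStep {N : ℕ} (Q : Kernel (Fin m → E) (Fin m → E)) (ν : Measure (Fin N → E)) :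
    Measure (Fin N → E) :=
  (N.choose m : ℝ≥0∞)⁻¹ • ∑ G : AgentGroup N m, ν.bind (groupKernel Q G)

/-- The law at time `t` of the configuration of `N` agents which start independently with law `μ`
and perform a step of the Kac walk at each jump of an independent Poisson process of intensity
`λ N / m`, so that the number of steps up to time `t` has the Poisson law of parameter
`(λ N / m) t`. -/
def systemLaw (Q : Kernel (Fin m → E) (Fin m → E)) (μ : Measure E) (lam t : ℝ≥0) (N : ℕ) :
    Measure (Fin N → E) :=
  (poissonMeasure (lam * ((N : ℝ≥0) / (m : ℝ≥0)) * t)).bind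
    fun k => (kacStep Q)^[k] (Measure.pi fun _ => μ)

/-- `μ_t^{*,N}`: the law at time `t` of the tagged agent `P` among `N` agents. -/
def agentLaw (Q : Kernel (Fin m → E) (Fin m → E)) (μ : Measure E) (lam t : ℝ≥0) (N : ℕ)
    (P : Fin N) : Measure E :=
  (systemLaw Q μ lam t N).map fun x => x P

/-! ### The tagged agent's tree, without the redundant interactions -/

/-- The probability `p_n(t)` that a pure birth process with `n`-th birth intensity `r n` has had `n`
births up to time `t`: the solution of Kolmogorov's system
`p_0' = -r_0 p_0`, `p_{n+1}' = r_n p_n - r_{n+1} p_{n+1}`, `p_n(0) = 1_{n=0}`, in integrated form. -/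
def birthProb (r : ℕ → ℝ) : ℕ → ℝ → ℝ
  | 0, t => Real.exp (-(r 0 * t))
  | n + 1, t => ∫ s in (0 : ℝ)..t, r n * birthProb r n s * Real.exp (-(r (n + 1) * (t - s)))

/-- `λ_{N,n} = λ (N/m) ((m-1)n+1) binom (N-((m-1)n+1)) (m-1) / binom N m`: the intensity, when the
history of the tagged agent involves `(m-1)n+1` agents, of the interactions of exactly one of them
with `m-1` new agents. The binomial coefficient is `0` if there are not enough agents. -/
def treeIntensity (m : ℕ) (lam : ℝ) (N n : ℕ) : ℝ :=
  lam * ((N : ℝ) / m * ((m - 1) * n + 1 : ℕ) * ((N - ((m - 1) * n + 1)).choose (m - 1) : ℕ)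
    / (N.choose m : ℕ))

/-- The law obtained for the tagged agent among `N` agents from the tree which remains of its
history up to time `t` when the redundant (cycle-creating) interactions are removed:
`Σ_n p_{N,n}(t) (1/#_m(n)) Σ_{A ∈ 𝔸_n} μ^{∘_m A}`. -/
def prunedAgentLaw [NeZero m] (Q : Kernel (Fin m → E) (Fin m → E)) (μ : Measure E)
    (lam t : ℝ≥0) (N : ℕ) : Measure E :=
  treeMixture Q μ fun n => birthProb (treeIntensity m lam N) n t

end

end ExtendedWild

/-! The tagged agent's law is bounded below by a mixture of tree laws that loses no mass in the
limit; convergence is then a matter of total mass.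

Follow the history of the tagged agent backwards in time. It is a tree whose leaves are labelled by
distinct agents, as long as each interacting group contains at most one of these agents. A group
disjoint from the labels leaves the tree unchanged; a group with exactly one labelled member
replaces that leaf by a node (`bind_groupKernel_lawAt`). Discarding all other groups gives a lower
bound (`prunedWeight_le`), with equality at time zero because distinct leaves carry independent
states of law `μ`.

Averaged over `𝔸_n`, the surviving histories form a chain on the number of nodes, killed at a
redundant interaction. At Poisson times it becomes a birth process with killing
(`poissonMean_killedChain`), with birth rate `λ_{N,n}` and total leaving rate `λ (N/m) (1 -
stayProb)`. For fixed `n` both rates tend to `λ((m-1)n+1)` as `N → ∞`, so killing disappears and the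
weights tend to `p_n(t)` (`tendsto_killedBirthProb`, `branchingProb_eq_birthProb`).

The negative binomial series gives `∑ p_n(t) = 1`. Fatou's lemma bounds the lower limit on `C` and
on its complement; since the measures have mass at most one, the second bound controls the upper
limit on `C` (`tendsto_treeMixture`). The second claim follows from the same criterion, the pruned
law being itself such a mixture. -/

namespace ExtendedWild

noncomputable section

/-! ### Birth processes with killing -/

/-- The probability that a chain on `ℕ` started at `0`, which jumps from `n` to `n + 1` at rate `b n`
and leaves `n` at total rate `d n`, is at `n` at time `t` (the rest `d n - b n` is a killing rate). -/
def killedBirthProb (b d : ℕ → ℝ) : ℕ → ℝ → ℝ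
  | 0, t => Real.exp (-(d 0 * t))
  | n + 1, t => ∫ s in (0 : ℝ)..t, b n * killedBirthProb b d n s * Real.exp (-(d (n + 1) * (t - s)))

theorem birthProb_eq_killedBirthProb (r : ℕ → ℝ) (n : ℕ) :
    birthProb r n = killedBirthProb r r n := by
  induction n with
  | zero => funext t; simp [birthProb, killedBirthProb]
  | succ n ih => funext t; simp [birthProb, killedBirthProb, ih]

/-- Splitting the exponential leaves `t` only in the prefactor and the upper endpoint, so that
continuity and the derivative follow directly. -/
theorem killedBirthProb_succ (b d : ℕ → ℝ) (n : ℕ) (t : ℝ) :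
    killedBirthProb b d (n + 1) t = Real.exp (-(d (n + 1) * t)) *
      ∫ s in (0 : ℝ)..t, b n * killedBirthProb b d n s * Real.exp (d (n + 1) * s) := by
  rw [killedBirthProb, ← intervalIntegral.integral_const_mul]
  congr 1
  funext s
  rw [show -(d (n + 1) * (t - s)) = -(d (n + 1) * t) + d (n + 1) * s by ring, Real.exp_add]
  ring

theorem continuous_killedBirthProb (b d : ℕ → ℝ) (n : ℕ) : Continuous (killedBirthProb b d n) := by
  induction n with
  | zero =>
    have : killedBirthProb b d 0 = fun t => Real.exp (-(d 0 * t)) := rfl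
    rw [this]; fun_prop
  | succ n ih =>
    have : killedBirthProb b d (n + 1) = fun t => Real.exp (-(d (n + 1) * t)) *
        ∫ s in (0 : ℝ)..t, b n * killedBirthProb b d n s * Real.exp (d (n + 1) * s) := by
      funext t; exact killedBirthProb_succ b d n t
    rw [this]
    refine Continuous.mul (by fun_prop) ?_
    exact intervalIntegral.continuous_primitive
      (fun a c => Continuous.intervalIntegrable (by fun_prop) a c) 0

theorem hasDerivAt_killedBirthProb_zero (b d : ℕ → ℝ) (t : ℝ) :
    HasDerivAt (killedBirthProb b d 0) (-(d 0 * killedBirthProb b d 0 t)) t := by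
  have h : HasDerivAt (fun t => Real.exp (-(d 0 * t))) (Real.exp (-(d 0 * t)) * (-(d 0 * 1))) t :=
    ((hasDerivAt_id t).const_mul (d 0)).neg.exp
  refine h.congr_deriv ?_
  simp only [killedBirthProb]
  ring

theorem hasDerivAt_killedBirthProb_succ (b d : ℕ → ℝ) (n : ℕ) (t : ℝ) :
    HasDerivAt (killedBirthProb b d (n + 1))
      (b n * killedBirthProb b d n t - d (n + 1) * killedBirthProb b d (n + 1) t) t := by
  have hc := continuous_killedBirthProb b d n
  have hg : Continuous fun s => b n * killedBirthProb b d n s * Real.exp (d (n + 1) * s) := by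
    fun_prop
  have h1 : HasDerivAt (fun t => Real.exp (-(d (n + 1) * t)))
      (Real.exp (-(d (n + 1) * t)) * (-(d (n + 1) * 1))) t :=
    ((hasDerivAt_id t).const_mul (d (n + 1))).neg.exp
  have h2 := intervalIntegral.integral_hasDerivAt_right (hg.intervalIntegrable 0 t)
    (hg.stronglyMeasurableAtFilter _ _) hg.continuousAt
  have h3 := h1.mul h2
  have : killedBirthProb b d (n + 1) = (fun t => Real.exp (-(d (n + 1) * t))) *
      fun t => ∫ s in (0 : ℝ)..t, b n * killedBirthProb b d n s * Real.exp (d (n + 1) * s) := by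
    funext t; exact killedBirthProb_succ b d n t
  rw [this]
  refine h3.congr_deriv ?_
  simp only [Pi.mul_apply]
  have he : Real.exp (-(d (n + 1) * t)) * Real.exp (d (n + 1) * t) = 1 := by
    rw [← Real.exp_add]; simp
  linear_combination (b n * killedBirthProb b d n t) * he

theorem killedBirthProb_at_zero (b d : ℕ → ℝ) (n : ℕ) :
    killedBirthProb b d n 0 = if n = 0 then 1 else 0 := by
  cases n <;> simp [killedBirthProb]

/-- A linear differential equation of order one has at most one solution. -/
theorem eq_of_hasDerivAt_linear {f g h : ℝ → ℝ} {c : ℝ}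
    (hf : ∀ t, HasDerivAt f (h t - c * f t) t) (hg : ∀ t, HasDerivAt g (h t - c * g t) t)
    (h0 : f 0 = g 0) : f = g := by
  funext t
  have he : ∀ s, HasDerivAt (fun s => Real.exp (c * s)) (Real.exp (c * s) * (c * 1)) s :=
    fun s => ((hasDerivAt_id s).const_mul c).exp
  have hd : ∀ s, HasDerivAt (fun s => (f s - g s) * Real.exp (c * s)) 0 s := fun s =>
    (((hf s).sub (hg s)).mul (he s)).congr_deriv (by simp only [Pi.sub_apply]; ring)
  have hconst := is_const_of_deriv_eq_zero (fun s => (hd s).differentiableAt)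
    (fun s => (hd s).deriv) t 0
  simp only [h0, sub_self, zero_mul, mul_eq_zero, (Real.exp_pos _).ne', or_false] at hconst
  linarith

/-- Kolmogorov's system is triangular, so uniqueness reduces to a scalar linear equation at each
level. This identifies both the explicit `p_n(t)` and the Poisson averages of the discrete chain. -/
theorem eq_killedBirthProb {b d : ℕ → ℝ} {f : ℕ → ℝ → ℝ}
    (h0 : ∀ n, f n 0 = if n = 0 then 1 else 0)
    (hz : ∀ t, HasDerivAt (f 0) (-(d 0 * f 0 t)) t)
    (hs : ∀ n t, HasDerivAt (f (n + 1)) (b n * f n t - d (n + 1) * f (n + 1) t) t) (n : ℕ) :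
    f n = killedBirthProb b d n := by
  induction n with
  | zero =>
    refine eq_of_hasDerivAt_linear (h := fun _ => 0) (c := d 0) (fun t => ?_) (fun t => ?_) ?_
    · simpa using hz t
    · simpa using hasDerivAt_killedBirthProb_zero b d t
    · rw [h0, killedBirthProb_at_zero]
  | succ n ih =>
    refine eq_of_hasDerivAt_linear (h := fun t => b n * killedBirthProb b d n t) (c := d (n + 1))
      (fun t => ?_) (fun t => hasDerivAt_killedBirthProb_succ b d n t) ?_
    · rw [← ih]; exact hs n t
    · rw [h0, killedBirthProb_at_zero]

theorem killedBirthProb_nonneg {b : ℕ → ℝ} (d : ℕ → ℝ) (hb : ∀ n, 0 ≤ b n) (n : ℕ) {t : ℝ}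
    (ht : 0 ≤ t) : 0 ≤ killedBirthProb b d n t := by
  induction n generalizing t with
  | zero => exact (Real.exp_pos _).le
  | succ n ih =>
    refine intervalIntegral.integral_nonneg ht fun s hs => ?_
    exact mul_nonneg (mul_nonneg (hb n) (ih hs.1)) (Real.exp_pos _).le

/-- The flows between neighbouring states telescope: what remains is killing below `M` and departure
from `M`. -/
theorem hasDerivAt_sum_killedBirthProb (b d : ℕ → ℝ) (M : ℕ) (t : ℝ) :
    HasDerivAt (fun t => ∑ n ∈ Finset.range (M + 1), killedBirthProb b d n t)
      (-(∑ n ∈ Finset.range M, (d n - b n) * killedBirthProb b d n t)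
        - d M * killedBirthProb b d M t) t := by
  induction M with
  | zero => simpa using hasDerivAt_killedBirthProb_zero b d t
  | succ M ih =>
    have h := ih.add (hasDerivAt_killedBirthProb_succ b d M t)
    simp_rw [Finset.sum_range_succ _ (M + 1)]
    refine h.congr_deriv ?_
    rw [Finset.sum_range_succ _ M]
    ring

theorem sum_killedBirthProb_le_one {b d : ℕ → ℝ} (hb : ∀ n, 0 ≤ b n) (hbd : ∀ n, b n ≤ d n)
    (M : ℕ) {t : ℝ} (ht : 0 ≤ t) :
    ∑ n ∈ Finset.range M, killedBirthProb b d n t ≤ 1 := by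
  rcases M with _ | M
  · simp
  set S : ℝ → ℝ := fun t => ∑ n ∈ Finset.range (M + 1), killedBirthProb b d n t with hS
  have hd := hasDerivAt_sum_killedBirthProb b d M
  have hanti : AntitoneOn S (Set.Ici 0) := by
    refine antitoneOn_of_deriv_nonpos (convex_Ici 0)
      (fun s _ => (hd s).continuousAt.continuousWithinAt)
      (fun s _ => (hd s).differentiableAt.differentiableWithinAt) fun s hs => ?_
    rw [interior_Ici] at hs
    rw [(hd s).deriv]
    have h1 : 0 ≤ ∑ n ∈ Finset.range M, (d n - b n) * killedBirthProb b d n s :=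
      Finset.sum_nonneg fun n _ => mul_nonneg (sub_nonneg.2 (hbd n))
        (killedBirthProb_nonneg d hb n (le_of_lt hs))
    have h2 : 0 ≤ d M * killedBirthProb b d M s :=
      mul_nonneg ((hb M).trans (hbd M)) (killedBirthProb_nonneg d hb M (le_of_lt hs))
    linarith
  have h0 : S 0 = 1 := by simp [hS, killedBirthProb_at_zero]
  exact h0 ▸ hanti Set.self_mem_Ici ht ht

theorem killedBirthProb_le_one {b d : ℕ → ℝ} (hb : ∀ n, 0 ≤ b n) (hbd : ∀ n, b n ≤ d n)
    (n : ℕ) {t : ℝ} (ht : 0 ≤ t) : killedBirthProb b d n t ≤ 1 :=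
  (Finset.single_le_sum (f := fun n => killedBirthProb b d n t)
    (fun i _ => killedBirthProb_nonneg d hb i ht) (Finset.self_mem_range_succ n)).trans
    (sum_killedBirthProb_le_one hb hbd (n + 1) ht)

/-- The weight at `n` depends on finitely many rates, so convergence of each rate, without
uniformity in `n`, suffices. -/
theorem tendsto_killedBirthProb {b d : ℕ → ℕ → ℝ} {b' d' : ℕ → ℝ}
    (hb0 : ∀ᶠ N in atTop, ∀ n, 0 ≤ b N n) (hbd : ∀ᶠ N in atTop, ∀ n, b N n ≤ d N n)
    (hb : ∀ n, Tendsto (fun N => b N n) atTop (𝓝 (b' n)))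
    (hd : ∀ n, Tendsto (fun N => d N n) atTop (𝓝 (d' n))) (n : ℕ) {t : ℝ} (ht : 0 ≤ t) :
    Tendsto (fun N => killedBirthProb (b N) (d N) n t) atTop (𝓝 (killedBirthProb b' d' n t)) := by
  induction n generalizing t with
  | zero =>
    simp only [killedBirthProb]
    exact (Real.continuous_exp.tendsto _).comp ((hd 0).mul_const t).neg
  | succ n ih =>
    simp only [killedBirthProb]
    refine intervalIntegral.tendsto_integral_filter_of_dominated_convergence
      -- Eventually `b N n < b' n + 1`; the probability and the exponential are at most `1`.
      (fun _ => b' n + 1) ?_ ?_ ?_ ?_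
    · refine Eventually.of_forall fun N => Continuous.aestronglyMeasurable ?_
      have := continuous_killedBirthProb (b N) (d N) n
      fun_prop
    · filter_upwards [hb0, hbd, (hb n).eventually_lt_const (lt_add_one (b' n))] with N h0 h1 h2
      refine Eventually.of_forall fun s hs => ?_
      rw [Set.uIoc_of_le ht] at hs
      have e1 := killedBirthProb_nonneg (d N) h0 n hs.1.le
      have e2 := killedBirthProb_le_one h0 h1 n hs.1.le
      have e3 : Real.exp (-(d N (n + 1) * (t - s))) ≤ 1 := by
        rw [Real.exp_le_one_iff, neg_nonpos]
        exact mul_nonneg ((h0 _).trans (h1 _)) (sub_nonneg.2 hs.2)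
      rw [Real.norm_of_nonneg (mul_nonneg (mul_nonneg (h0 n) e1) (Real.exp_pos _).le)]
      calc b N n * killedBirthProb (b N) (d N) n s * Real.exp (-(d N (n + 1) * (t - s)))
          ≤ b N n * 1 * 1 :=
            mul_le_mul (mul_le_mul_of_nonneg_left e2 (h0 n)) e3 (Real.exp_pos _).le
              (mul_nonneg (h0 n) zero_le_one)
        _ ≤ b' n + 1 := by linarith
    · simp
    · refine Eventually.of_forall fun s hs => ?_
      rw [Set.uIoc_of_le ht] at hs
      exact ((hb n).mul (ih hs.1.le)).mul ((Real.continuous_exp.tendsto _).comp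
        (((hd (n + 1)).mul_const (t - s)).neg))

/-! ### Poisson averages -/

/-- The average of the sequence `c` under the Poisson law of parameter `x`. -/
def poissonMean (c : ℕ → ℝ) (x : ℝ) : ℝ := ∑' k, Real.exp (-x) * x ^ k / k.factorial * c k

theorem summable_pow_div_factorial_mul {c : ℕ → ℝ} {B : ℝ} (hc : ∀ k, |c k| ≤ B) (x : ℝ) :
    Summable fun k => x ^ k / k.factorial * c k := by
  refine Summable.of_norm_bounded ((Real.summable_pow_div_factorial |x|).mul_right B) fun k => ?_
  rw [norm_mul, norm_div, norm_pow, Real.norm_eq_abs, Real.norm_eq_abs, Real.norm_eq_abs,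
    Nat.abs_cast]
  exact mul_le_mul_of_nonneg_left (hc k) (by positivity)

theorem hasDerivAt_tsum_pow_div_factorial {c : ℕ → ℝ} {B : ℝ} (hc : ∀ k, |c k| ≤ B) (x : ℝ) :
    HasDerivAt (fun x : ℝ => ∑' k, x ^ k / k.factorial * c k)
      (∑' k, x ^ k / k.factorial * c (k + 1)) x := by
  -- Any radius beyond `|x|` works: termwise differentiation needs a summable bound on a
  -- neighbourhood of `x`.
  set R : ℝ := |x| + 1
  have hder : ∀ (k : ℕ) (y : ℝ), HasDerivAt (fun y : ℝ => y ^ k / k.factorial * c k)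
      (k * y ^ (k - 1) / k.factorial * c k) y := fun k y =>
    ((hasDerivAt_pow k y).div_const _).mul_const _
  have hsucc : ∀ (k : ℕ) (y : ℝ), ((k + 1 : ℕ) : ℝ) * y ^ (k + 1 - 1) / (k + 1).factorial
      = y ^ k / k.factorial := by
    intro k y
    rw [Nat.factorial_succ, Nat.cast_mul, Nat.add_sub_cancel]
    field_simp
  have hu : Summable fun k : ℕ => (k : ℝ) * R ^ (k - 1) / k.factorial * B := by
    refine Summable.mul_right _ ?_
    rw [← summable_nat_add_iff 1]
    simp_rw [hsucc]
    exact Real.summable_pow_div_factorial R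
  have hmem : x ∈ Metric.ball (0 : ℝ) R := by simp [R]
  have h := hasDerivAt_tsum_of_isPreconnected hu Metric.isOpen_ball
    (convex_ball (0 : ℝ) R).isPreconnected (fun k y _ => hder k y) (fun k y hy => ?_) hmem
    (summable_pow_div_factorial_mul hc x) hmem
  · refine h.congr_deriv ?_
    have hs : Summable fun k : ℕ => (k : ℝ) * x ^ (k - 1) / k.factorial * c k := by
      rw [← summable_nat_add_iff 1]
      simp_rw [hsucc]
      exact summable_pow_div_factorial_mul (fun k => hc (k + 1)) x
    rw [hs.tsum_eq_zero_add]
    simp_rw [hsucc]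
    simp
  · rw [mem_ball_zero_iff, Real.norm_eq_abs] at hy
    rw [norm_mul, norm_div, norm_mul, norm_pow, Real.norm_eq_abs, Real.norm_eq_abs,
      Real.norm_eq_abs, Real.norm_eq_abs, Nat.abs_cast, Nat.abs_cast]
    have : 0 ≤ B := (abs_nonneg _).trans (hc 0)
    gcongr
    exact hc k

theorem poissonMean_eq (c : ℕ → ℝ) (x : ℝ) :
    poissonMean c x = Real.exp (-x) * ∑' k, x ^ k / k.factorial * c k := by
  rw [poissonMean, ← tsum_mul_left]
  congr 1; funext k; ring

/-- The generator of the unit Poisson process is the forward difference. -/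
theorem hasDerivAt_poissonMean {c : ℕ → ℝ} {B : ℝ} (hc : ∀ k, |c k| ≤ B) (x : ℝ) :
    HasDerivAt (poissonMean c) (poissonMean (fun k => c (k + 1)) x - poissonMean c x) x := by
  have : poissonMean c = (fun x => Real.exp (-x)) * fun x => ∑' k, x ^ k / k.factorial * c k := by
    funext x; exact poissonMean_eq c x
  have h1 : HasDerivAt (fun x : ℝ => Real.exp (-x)) (Real.exp (-x) * -1) x :=
    (hasDerivAt_id x).neg.exp
  have h := h1.mul (hasDerivAt_tsum_pow_div_factorial hc x)
  rw [poissonMean_eq, poissonMean_eq, this]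
  exact h.congr_deriv (by ring)

theorem poissonMean_zero (c : ℕ → ℝ) : poissonMean c 0 = c 0 := by
  rw [poissonMean_eq, tsum_eq_single 0]
  · simp
  · intro k hk; simp [hk]

theorem poissonMean_linear {c c' : ℕ → ℝ} {B B' : ℝ} (hc : ∀ k, |c k| ≤ B) (hc' : ∀ k, |c' k| ≤ B')
    (a a' x : ℝ) :
    poissonMean (fun k => a * c k + a' * c' k) x = a * poissonMean c x + a' * poissonMean c' x := by
  simp_rw [poissonMean_eq]
  have e : ∀ k : ℕ, x ^ k / k.factorial * (a * c k + a' * c' k)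
      = a * (x ^ k / k.factorial * c k) + a' * (x ^ k / k.factorial * c' k) := fun k => by ring
  simp_rw [e]
  rw [Summable.tsum_add ((summable_pow_div_factorial_mul hc x).mul_left a)
    ((summable_pow_div_factorial_mul hc' x).mul_left a'), tsum_mul_left, tsum_mul_left]
  ring

/-! ### Killed chains in discrete time and their Poissonization -/

/-- The law after `k` steps of the chain on `ℕ`, started at `0`, which stays at `n` with probability
`s n`, jumps to `n + 1` with probability `j n`, and is killed otherwise. -/
def killedChain (s j : ℕ → ℝ) : ℕ → ℕ → ℝ
  | 0, n => if n = 0 then 1 else 0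
  | k + 1, 0 => s 0 * killedChain s j k 0
  | k + 1, n + 1 => s (n + 1) * killedChain s j k (n + 1) + j n * killedChain s j k n

theorem killedChain_nonneg {s j : ℕ → ℝ} (hs : ∀ n, 0 ≤ s n) (hj : ∀ n, 0 ≤ j n) (k n : ℕ) :
    0 ≤ killedChain s j k n := by
  induction k generalizing n with
  | zero => rw [killedChain]; split_ifs <;> simp
  | succ k ih =>
    cases n with
    | zero => exact mul_nonneg (hs 0) (ih 0)
    | succ n => exact add_nonneg (mul_nonneg (hs _) (ih _)) (mul_nonneg (hj _) (ih _))

theorem sum_killedChain_le_one {s j : ℕ → ℝ} (hs : ∀ n, 0 ≤ s n) (hj : ∀ n, 0 ≤ j n)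
    (hsj : ∀ n, s n + j n ≤ 1) (k M : ℕ) : ∑ n ∈ Finset.range M, killedChain s j k n ≤ 1 := by
  induction k generalizing M with
  | zero =>
    simp only [killedChain, Finset.sum_ite_eq', Finset.mem_range]
    split_ifs <;> simp
  | succ k ih =>
    -- Mass on `{0,…,M}` after a step comes from staying or jumping below `M`, or from staying at
    -- `M`; the jump out of `M` leaves the range.
    have key : ∀ M, ∑ n ∈ Finset.range (M + 1), killedChain s j (k + 1) n
        = ∑ n ∈ Finset.range M, (s n + j n) * killedChain s j k n + s M * killedChain s j k M := by
      intro M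
      induction M with
      | zero => simp [killedChain]
      | succ M ihM =>
        rw [Finset.sum_range_succ, ihM, Finset.sum_range_succ _ M, killedChain]
        ring
    rcases M with _ | M
    · simp
    rw [key]
    refine le_trans ?_ (ih (M + 1))
    rw [Finset.sum_range_succ]
    have h := killedChain_nonneg hs hj k
    refine add_le_add (Finset.sum_le_sum fun n _ => ?_) ?_
    · exact mul_le_of_le_one_left (h n) (hsj n)
    · exact mul_le_of_le_one_left (h M) (by linarith [hsj M, hj M])

theorem abs_killedChain_le_one {s j : ℕ → ℝ} (hs : ∀ n, 0 ≤ s n) (hj : ∀ n, 0 ≤ j n)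
    (hsj : ∀ n, s n + j n ≤ 1) (k n : ℕ) : |killedChain s j k n| ≤ 1 := by
  rw [abs_of_nonneg (killedChain_nonneg hs hj k n)]
  exact (Finset.single_le_sum (f := killedChain s j k) (fun i _ => killedChain_nonneg hs hj k i)
    (Finset.self_mem_range_succ n)).trans (sum_killedChain_le_one hs hj hsj k (n + 1))

/-- Performing the steps of the chain at the jumps of a Poisson process. -/
theorem poissonMean_killedChain {s j : ℕ → ℝ} (hs : ∀ n, 0 ≤ s n) (hj : ∀ n, 0 ≤ j n)
    (hsj : ∀ n, s n + j n ≤ 1) (r : ℝ) (n : ℕ) (t : ℝ) :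
    poissonMean (fun k => killedChain s j k n) (r * t)
      = killedBirthProb (fun n => r * j n) (fun n => r * (1 - s n)) n t := by
  have hc : ∀ n k, |killedChain s j k n| ≤ 1 := fun n k => abs_killedChain_le_one hs hj hsj k n
  have hd : ∀ n t, HasDerivAt (fun t => poissonMean (fun k => killedChain s j k n) (r * t))
      ((poissonMean (fun k => killedChain s j (k + 1) n) (r * t)
        - poissonMean (fun k => killedChain s j k n) (r * t)) * (r * 1)) t := fun n t =>
    (hasDerivAt_poissonMean (hc n) (r * t)).comp t ((hasDerivAt_id t).const_mul r)
  refine congrFun (eq_killedBirthProb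
    (f := fun n t => poissonMean (fun k => killedChain s j k n) (r * t)) ?_ ?_ ?_ n) t
  · intro n
    simp [poissonMean_zero, killedChain]
  · intro t
    refine (hd 0 t).congr_deriv ?_
    have h := poissonMean_linear (hc 0) (hc 0) (s 0) 0 (r * t)
    simp only [zero_mul, add_zero] at h
    simp only [killedChain]
    rw [h]
    ring
  · intro n t
    refine (hd (n + 1) t).congr_deriv ?_
    have h := poissonMean_linear (hc (n + 1)) (hc n) (s (n + 1)) (j n) (r * t)
    simp only [killedChain]
    rw [h]
    ring

/-! ### The limiting birth process -/

theorem numTrees_succ (m n : ℕ) : numTrees m (n + 1) = numTrees m n * ((m - 1) * n + 1) := by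
  rcases Nat.eq_zero_or_pos n with rfl | hn
  · simp [numTrees]
  · rw [numTrees, numTrees, Finset.prod_Ico_succ_top hn]

theorem numTrees_pos (m n : ℕ) : 0 < numTrees m n :=
  Finset.prod_pos fun _ _ => Nat.succ_pos _

theorem hasDerivAt_branchingProb_zero (m : ℕ) (lam t : ℝ) :
    HasDerivAt (fun t => branchingProb m lam t 0) (-(lam * branchingProb m lam t 0)) t := by
  have h : HasDerivAt (fun t => Real.exp (-(lam * t))) (Real.exp (-(lam * t)) * (-(lam * 1))) t :=
    ((hasDerivAt_id t).const_mul lam).neg.exp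
  simp only [branchingProb, numTrees, zero_le, Finset.Ico_eq_empty_of_le, Finset.prod_empty,
    Nat.cast_one, pow_zero, Nat.factorial_zero, mul_one, div_one, one_mul]
  exact h.congr_deriv (by ring)

/-- Writing `e^{-(m-1)λt} = 1 - (1 - e^{-(m-1)λt})` in the derivative of the power splits it into a
gain and a loss term; the coefficients match because `#_m(n+1) = #_m(n)((m-1)n+1)`. -/
theorem hasDerivAt_branchingProb_succ {m : ℕ} (hm : 2 ≤ m) (lam : ℝ) (n : ℕ) (t : ℝ) :
    HasDerivAt (fun t => branchingProb m lam t (n + 1))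
      (lam * ((m - 1) * n + 1 : ℕ) * branchingProb m lam t n
        - lam * ((m - 1) * (n + 1) + 1 : ℕ) * branchingProb m lam t (n + 1)) t := by
  have hm' : ((m - 1 : ℕ) : ℝ) = (m : ℝ) - 1 := by push_cast [show 1 ≤ m by omega]; ring
  have hpos : (0 : ℝ) < (m : ℝ) - 1 := by
    rw [← hm']; exact_mod_cast (show 0 < m - 1 by omega)
  set q : ℝ := (m : ℝ) - 1 with hq
  have h1 : HasDerivAt (fun t => Real.exp (-(lam * t))) (Real.exp (-(lam * t)) * (-(lam * 1))) t :=
    ((hasDerivAt_id t).const_mul lam).neg.exp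
  have h2 : HasDerivAt (fun t => Real.exp (-(q * lam * t)))
      (Real.exp (-(q * lam * t)) * (-(q * lam * 1))) t :=
    ((hasDerivAt_id t).const_mul (q * lam)).neg.exp
  have h3 := (h1.const_mul (numTrees m (n + 1) / (q ^ (n + 1) * (n + 1).factorial))).mul
    ((h2.const_sub 1).pow (n + 1))
  refine h3.congr_deriv ?_
  simp only [branchingProb, ← hq, Pi.pow_apply, numTrees_succ, Nat.factorial_succ]
  set u := Real.exp (-(q * lam * t))
  set e := Real.exp (-(lam * t))
  push_cast
  rw [hm']
  field_simp
  ring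

theorem branchingProb_eq_birthProb {m : ℕ} (hm : 2 ≤ m) (lam : ℝ) (n : ℕ) (t : ℝ) :
    branchingProb m lam t n = killedBirthProb (fun n => lam * ((m - 1) * n + 1 : ℕ))
      (fun n => lam * ((m - 1) * n + 1 : ℕ)) n t := by
  refine congrFun (eq_killedBirthProb (f := fun n t => branchingProb m lam t n) ?_ ?_ ?_ n) t
  · intro n
    cases n <;> simp [branchingProb, numTrees]
  · intro t
    simpa using hasDerivAt_branchingProb_zero m lam t
  · exact fun n t => hasDerivAt_branchingProb_succ hm lam n t

/-- Both sides are the rising factorial of `1/(m-1)` divided by `n!`. -/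
theorem choose_eq_numTrees_div {m : ℕ} (hm : 2 ≤ m) (n : ℕ) :
    Ring.choose ((1 / ((m : ℝ) - 1)) + n - 1) n
      = numTrees m n / (((m : ℝ) - 1) ^ n * n.factorial) := by
  have hm' : ((m - 1 : ℕ) : ℝ) = (m : ℝ) - 1 := by push_cast [show 1 ≤ m by omega]; ring
  have hpos : (0 : ℝ) < (m : ℝ) - 1 := by
    rw [← hm']; exact_mod_cast (show 0 < m - 1 by omega)
  rw [← Ring.multichoose_eq]
  have h := Ring.factorial_nsmul_multichoose_eq_ascPochhammer (1 / ((m : ℝ) - 1)) n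
  rw [Polynomial.ascPochhammer_smeval_eq_eval, nsmul_eq_mul] at h
  have h2 : (ascPochhammer ℝ n).eval (1 / ((m : ℝ) - 1)) = numTrees m n / ((m : ℝ) - 1) ^ n := by
    clear h
    induction n with
    | zero => simp [numTrees]
    | succ n ih =>
      rw [ascPochhammer_succ_eval, ih, numTrees_succ]
      push_cast
      rw [hm']
      field_simp
      ring
  rw [h2] at h
  field_simp at h ⊢
  linarith

/-- The series for `(1-x)^{-1/(m-1)}` at `x = 1 - e^{-(m-1)λt}` sums to `e^{λt}`, which cancels the
factor `e^{-λt}`. -/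
theorem hasSum_branchingProb {m : ℕ} (hm : 2 ≤ m) {lam t : ℝ} (hl : 0 ≤ lam) (ht : 0 ≤ t) :
    HasSum (branchingProb m lam t) 1 := by
  have hm' : ((m - 1 : ℕ) : ℝ) = (m : ℝ) - 1 := by push_cast [show 1 ≤ m by omega]; ring
  have hpos : (0 : ℝ) < (m : ℝ) - 1 := by
    rw [← hm']; exact_mod_cast (show 0 < m - 1 by omega)
  set x : ℝ := 1 - Real.exp (-(((m : ℝ) - 1) * lam * t)) with hx
  have hx0 : 0 ≤ x := by
    rw [hx, sub_nonneg, Real.exp_le_one_iff]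
    have : 0 ≤ ((m : ℝ) - 1) * lam * t := by positivity
    linarith
  have hx1 : x < 1 := by rw [hx]; linarith [Real.exp_pos (-(((m : ℝ) - 1) * lam * t))]
  have h := (Real.one_div_one_sub_rpow_hasFPowerSeriesOnBall_zero (1 / ((m : ℝ) - 1))).hasSum
    (y := x) (by simp [Real.enorm_eq_ofReal hx0, hx1])
  have h2 := h.mul_left (Real.exp (-(lam * t)))
  have e1 : ∀ n, branchingProb m lam t n = Real.exp (-(lam * t)) *
      (FormalMultilinearSeries.ofScalars ℝ
        (fun n => Ring.choose (1 / ((m : ℝ) - 1) + n - 1) n) n) fun _ => x := by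
    intro n
    simp only [FormalMultilinearSeries.ofScalars_apply_eq, smul_eq_mul, choose_eq_numTrees_div hm,
      branchingProb, ← hx]
    ring
  have e2 : Real.exp (-(lam * t)) * (1 / (1 - (0 + x)) ^ (1 / ((m : ℝ) - 1))) = 1 := by
    simp only [hx, zero_add, sub_sub_cancel]
    rw [← Real.exp_mul, one_div, ← Real.exp_neg, ← Real.exp_add, Real.exp_eq_one_iff]
    field_simp
    ring
  rw [e2] at h2
  exact h2.congr_fun e1

end

noncomputable section

/-! ### Trees with labelled leaves -/

/-- Ordered `m`-ary trees whose leaves carry labels in `α`. -/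
inductive LTree (m : ℕ) (α : Type*) : Type _
  | leaf (a : α) : LTree m α
  | node (children : Fin m → LTree m α) : LTree m α

namespace LTree

variable {m : ℕ} {α : Type*}

/-- The tree without its labels. -/
def shape : LTree m α → MTree m
  | leaf _ => .leaf
  | node c => .node fun i => (c i).shape

variable [DecidableEq α]

/-- The labels of the leaves. -/
def labels : LTree m α → Finset α
  | leaf a => {a}
  | node c => Finset.univ.biUnion fun i => (c i).labels

/-- All leaves have different labels. -/
def Distinct : LTree m α → Prop
  | leaf _ => True
  | node c => (∀ i, (c i).Distinct) ∧ ∀ i j, i ≠ j → Disjoint (c i).labels (c j).labels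

/-- Replace each leaf labelled `a` by an internal node whose children are leaves labelled by `e`. -/
def graft (a : α) (e : Fin m → α) : LTree m α → LTree m α
  | leaf b => if b = a then node fun i => leaf (e i) else leaf b
  | node c => node fun i => (c i).graft a e

theorem labels_subset_labels_node (c : Fin m → LTree m α) (i : Fin m) :
    (c i).labels ⊆ (node c).labels :=
  Finset.subset_biUnion_of_mem (fun i => (c i).labels) (Finset.mem_univ i)

theorem graft_of_notMem {a : α} (e : Fin m → α) {T : LTree m α} (h : a ∉ T.labels) :
    T.graft a e = T := by
  induction T with
  | leaf b =>
    rw [labels, Finset.mem_singleton] at h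
    simp [graft, Ne.symm h]
  | node c ih =>
    simp only [graft]
    congr 1
    funext i
    exact ih i fun hi => h (labels_subset_labels_node c i hi)

theorem card_labels {T : LTree m α} (hT : T.Distinct) : T.labels.card = T.shape.numLeaves := by
  induction T with
  | leaf a => simp [labels, shape, MTree.numLeaves]
  | node c ih =>
    rw [labels, Finset.card_biUnion fun i _ j _ hij => hT.2 i j hij]
    simp only [shape, MTree.numLeaves]
    exact Finset.sum_congr rfl fun i _ => ih i (hT.1 i)

theorem labels_graft_subset (a : α) (e : Fin m → α) (T : LTree m α) :
    (T.graft a e).labels ⊆ T.labels ∪ Finset.univ.image e := by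
  induction T with
  | leaf b =>
    rw [graft]
    split_ifs
    · refine Finset.Subset.trans (fun x hx => ?_) Finset.subset_union_right
      simpa [labels, eq_comm] using hx
    · exact Finset.subset_union_left
  | node c ih =>
    rw [graft, labels]
    refine Finset.biUnion_subset.2 fun i _ => (ih i).trans ?_
    exact Finset.union_subset_union_left (labels_subset_labels_node c i)

/-- The label `a` may reappear among the `e i`, since an interacting agent keeps its name: its only
old leaf is the one replaced. -/
theorem Distinct.graft {a : α} {e : Fin m → α} (he : Function.Injective e) {T : LTree m α}
    (hT : T.Distinct) (h : ∀ i, e i ∈ T.labels → e i = a) : (T.graft a e).Distinct := by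
  induction T with
  | leaf b =>
    rw [LTree.graft]
    split_ifs
    · refine ⟨fun i => trivial, fun i j hij => ?_⟩
      simpa [labels] using he.ne hij
    · trivial
  | node c ih =>
    have hsub := labels_subset_labels_node c
    have key : ∀ i j, i ≠ j → a ∉ (c j).labels →
        Disjoint ((c i).graft a e).labels (c j).labels := by
      intro i j hij haj
      refine Finset.disjoint_of_subset_left (labels_graft_subset a e (c i)) ?_
      rw [Finset.disjoint_union_left]
      refine ⟨hT.2 i j hij, Finset.disjoint_left.2 fun x hx hxj => ?_⟩
      obtain ⟨k, -, rfl⟩ := Finset.mem_image.1 hx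
      exact haj (h k (hsub j hxj) ▸ hxj)
    refine ⟨fun i => ih i (hT.1 i) fun k hk => h k (hsub i hk), fun i j hij => ?_⟩
    change Disjoint ((c i).graft a e).labels ((c j).graft a e).labels
    by_cases haj : a ∈ (c j).labels
    · have hai : a ∉ (c i).labels := fun hai => Finset.disjoint_left.1 (hT.2 i j hij) hai haj
      rw [graft_of_notMem e hai]
      exact (key j i hij.symm hai).symm
    · rw [graft_of_notMem e haj]
      exact key i j hij haj

theorem shape_graft_node {c : Fin m → LTree m α} (hT : (node c).Distinct) {i : Fin m} {a : α}
    (ha : a ∈ (c i).labels) (e : Fin m → α) :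
    ((node c).graft a e).shape
      = .node (Function.update (fun j => (c j).shape) i ((c i).graft a e).shape) := by
  simp only [graft, shape]
  congr 1
  funext j
  by_cases hij : j = i
  · subst hij; simp
  · rw [Function.update_of_ne hij, graft_of_notMem]
    exact fun haj => Finset.disjoint_left.1 (hT.2 j i hij) haj ha

/-- Grafting at the different leaves of a labelled tree gives the trees grown from its shape. -/
theorem sum_shape_graft {M : Type*} [AddCommMonoid M] (g : MTree m → M) {T : LTree m α}
    (hT : T.Distinct) (e : α → Fin m → α) :
    ∑ a ∈ T.labels, g (T.graft a (e a)).shape = (T.shape.grow.map g).sum := by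
  induction T generalizing g with
  | leaf b => simp [labels, graft, shape, MTree.grow]
  | node c ih =>
    rw [labels, Finset.sum_biUnion fun i _ j _ hij => hT.2 i j hij]
    simp only [shape, MTree.grow]
    rw [← Multiset.coe_mapAddMonoidHom, map_sum, ← Multiset.coe_sumAddMonoidHom, map_sum]
    refine Finset.sum_congr rfl fun i _ => ?_
    rw [Multiset.coe_mapAddMonoidHom, Multiset.coe_sumAddMonoidHom, Multiset.map_map,
      Function.comp_def, ← ih i _ (hT.1 i)]
    exact Finset.sum_congr rfl fun a ha => by rw [shape_graft_node hT ha]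

end LTree

/-! ### Laws along labelled trees -/

variable {E : Type*} [MeasurableSpace E] {m : ℕ} {α : Type*}
variable {Ω : Type*} {mΩ : MeasurableSpace Ω}

theorem measurable_measure_pi {κ : Fin m → Ω → Measure E} [∀ i ω, IsProbabilityMeasure (κ i ω)]
    (hκ : ∀ i, Measurable (κ i)) : Measurable fun ω => Measure.pi fun i => κ i ω := by
  refine Measurable.measure_of_isPiSystem_of_isProbabilityMeasure generateFrom_pi.symm
    isPiSystem_pi ?_
  rintro _ ⟨C, hC, rfl⟩
  simp only [Measure.pi_pi]
  exact Finset.measurable_prod _ fun i _ =>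
    (Measure.measurable_coe (hC i (Set.mem_univ i))).comp (hκ i)

variable [NeZero m] (Q : Kernel (Fin m → E) (Fin m → E))

instance isProbabilityMeasure_interactionLaw [IsMarkovKernel Q] (ν : Fin m → Measure E)
    [∀ i, IsProbabilityMeasure (ν i)] : IsProbabilityMeasure (interactionLaw Q ν) := by
  have : IsProbabilityMeasure ((Measure.pi ν).bind Q) :=
    isProbabilityMeasure_bind Q.aemeasurable (Eventually.of_forall fun _ => inferInstance)
  exact Measure.isProbabilityMeasure_map (measurable_pi_apply 0).aemeasurable

theorem measurable_interactionLaw {κ : Fin m → Ω → Measure E}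
    [∀ i ω, IsProbabilityMeasure (κ i ω)] (hκ : ∀ i, Measurable (κ i)) :
    Measurable fun ω => interactionLaw Q fun i => κ i ω :=
  (Measure.measurable_map _ (measurable_pi_apply 0)).comp
    ((Measure.measurable_bind' Q.measurable).comp (measurable_measure_pi hκ))

instance isProbabilityMeasure_treeLaw [IsMarkovKernel Q] (μ : Measure E) [IsProbabilityMeasure μ] (T : MTree m) :
    IsProbabilityMeasure (treeLaw Q μ T) := by
  induction T with
  | leaf => assumption
  | node c ih => exact isProbabilityMeasure_interactionLaw Q _

/-- The law at the root of a labelled tree when `ν a` is placed on the leaves labelled `a` and the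
interaction is performed at each internal node. -/
def LTree.law (ν : α → Measure E) : LTree m α → Measure E
  | .leaf a => ν a
  | .node c => interactionLaw Q fun i => (c i).law ν

theorem LTree.law_const (μ : Measure E) (T : LTree m α) :
    T.law Q (fun _ => μ) = treeLaw Q μ T.shape := by
  induction T with
  | leaf a => rfl
  | node c ih => simp only [LTree.law, LTree.shape, treeLaw, ih]

instance LTree.isProbabilityMeasure_law [IsMarkovKernel Q] (ν : α → Measure E) [∀ a, IsProbabilityMeasure (ν a)]
    (T : LTree m α) : IsProbabilityMeasure (T.law Q ν) := by
  induction T with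
  | leaf a => exact inferInstanceAs (IsProbabilityMeasure (ν a))
  | node c ih => exact isProbabilityMeasure_interactionLaw Q _

theorem LTree.law_congr [DecidableEq α] {ν ν' : α → Measure E} (T : LTree m α)
    (h : ∀ a ∈ T.labels, ν a = ν' a) : T.law Q ν = T.law Q ν' := by
  induction T with
  | leaf a => exact h a (Finset.mem_singleton_self a)
  | node c ih =>
    simp only [LTree.law]
    congr 1
    funext i
    exact ih i fun a ha => h a (labels_subset_labels_node c i ha)

/-- A new node acts only through the law which it produces in the place of the old leaf. -/
theorem LTree.law_graft [DecidableEq α] (ν : α → Measure E) (a : α) (e : Fin m → α) (T : LTree m α) :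
    (T.graft a e).law Q ν
      = T.law Q (Function.update ν a (interactionLaw Q fun i => ν (e i))) := by
  induction T with
  | leaf b =>
    by_cases h : b = a
    · subst h; simp [graft, law]
    · simp [graft, law, h]
  | node c ih => simp only [graft, law, ih]

/-- Measurability is asked only at the labels occurring in `T`, so that the lemma also applies to
the σ-algebra generated by those variables alone. -/
theorem LTree.measurable_law [DecidableEq α] [IsMarkovKernel Q] {ν : α → Ω → Measure E} [∀ a ω, IsProbabilityMeasure (ν a ω)]
    (T : LTree m α) (h : ∀ a ∈ T.labels, Measurable (ν a)) :
    Measurable fun ω => T.law Q fun a => ν a ω := by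
  induction T with
  | leaf a => exact h a (Finset.mem_singleton_self a)
  | node c ih =>
    exact measurable_interactionLaw Q (κ := fun i ω => (c i).law Q fun a => ν a ω)
      fun i => ih i fun a ha => h a (labels_subset_labels_node c i ha)

/-- Functions of disjoint families of independent random variables are independent: the expectation
of their product is the product of the expectations. -/
theorem lintegral_prod_of_disjoint_blocks {ι : Type*} {P : Measure Ω}
    {f : α → Ω → E} (hf : ∀ a, Measurable (f a)) (h : iIndepFun f P) (B : ι → Set α)
    (hB : ∀ i j, i ≠ j → Disjoint (B i) (B j)) (X : ι → Ω → ℝ≥0∞)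
    (hX : ∀ i, Measurable[⨆ a ∈ B i, MeasurableSpace.comap (f a) inferInstance] (X i))
    (s : Finset ι) : ∫⁻ ω, ∏ i ∈ s, X i ω ∂P = ∏ i ∈ s, ∫⁻ ω, X i ω ∂P := by
  have : IsProbabilityMeasure P := h.isProbabilityMeasure
  have hle : ∀ a, MeasurableSpace.comap (f a) inferInstance ≤ mΩ := fun a => (hf a).comap_le
  have hleB : ∀ S : Set α, ⨆ a ∈ S, MeasurableSpace.comap (f a) inferInstance ≤ mΩ :=
    fun S => iSup₂_le fun a _ => hle a
  induction s using Finset.cons_induction with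
  | empty => simp
  | cons j s hj ih =>
    simp only [Finset.prod_cons, ← ih]
    have hdisj : Disjoint (B j) (⋃ i ∈ s, B i) := by
      rw [Set.disjoint_iUnion₂_right]
      exact fun i hi => hB j i fun e => hj (e ▸ hi)
    refine lintegral_mul_eq_lintegral_mul_lintegral_of_independent_measurableSpace
      (hleB (B j)) (hleB (⋃ i ∈ s, B i)) (indep_iSup_of_disjoint hle h hdisj) (hX j) ?_
    refine Finset.measurable_prod (m := ⨆ a ∈ ⋃ i ∈ s, B i, MeasurableSpace.comap (f a) inferInstance)
      s fun i hi => (hX i).mono ?_ le_rfl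
    exact biSup_mono fun a ha => Set.mem_biUnion hi ha

/-- Placing independent random variables on the leaves and averaging amounts to placing their laws
on the leaves. -/
theorem LTree.bind_law_dirac [DecidableEq α] [IsMarkovKernel Q] {P : Measure Ω} {f : α → Ω → E} (hf : ∀ a, Measurable (f a))
    (h : iIndepFun f P) {T : LTree m α} (hT : T.Distinct) :
    P.bind (fun ω => T.law Q fun a => Measure.dirac (f a ω)) = T.law Q fun a => P.map (f a) := by
  have : IsProbabilityMeasure P := h.isProbabilityMeasure
  have : ∀ a, IsProbabilityMeasure (P.map (f a)) := fun a =>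
    Measure.isProbabilityMeasure_map (hf a).aemeasurable
  have hmeas : ∀ T : LTree m α, Measurable fun ω => T.law Q fun a => Measure.dirac (f a ω) :=
    fun T => T.measurable_law Q (ν := fun a ω => Measure.dirac (f a ω))
      fun a _ => Measure.measurable_dirac.comp (hf a)
  induction T with
  | leaf a => exact Measure.bind_dirac_eq_map P (hf a)
  | node c ih =>
    have hpi : Measurable fun ω => Measure.pi fun i => (c i).law Q fun a => Measure.dirac (f a ω) :=
      measurable_measure_pi (κ := fun i ω => (c i).law Q fun a => Measure.dirac (f a ω))
        fun i => hmeas (c i)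
    have key : P.bind (fun ω => Measure.pi fun i => (c i).law Q fun a => Measure.dirac (f a ω))
        = Measure.pi fun i => (c i).law Q fun a => P.map (f a) := by
      refine (Measure.pi_eq fun C hC => ?_).symm
      rw [Measure.bind_apply (MeasurableSet.univ_pi hC) hpi.aemeasurable]
      simp only [Measure.pi_pi]
      -- Distinct labels make the subtrees functions of disjoint blocks of independent variables.
      rw [lintegral_prod_of_disjoint_blocks hf h (fun i => ((c i).labels : Set α))
        (fun i j hij => Finset.disjoint_coe.2 (hT.2 i j hij))]
      · refine Finset.prod_congr rfl fun i _ => ?_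
        rw [← Measure.bind_apply (hC i) (hmeas (c i)).aemeasurable, ih i (hT.1 i)]
      · intro i
        refine (Measure.measurable_coe (hC i)).comp ?_
        refine @LTree.measurable_law E _ m α Ω
          (⨆ a ∈ ((c i).labels : Set α), MeasurableSpace.comap (f a) inferInstance) _ Q _ _
          (fun a ω => Measure.dirac (f a ω)) _ (c i) fun a ha => ?_
        refine Measure.measurable_dirac.comp ?_
        refine (comap_measurable (f a)).mono ?_ le_rfl
        exact le_biSup (fun a => MeasurableSpace.comap (f a) inferInstance) ha
    simp only [LTree.law, interactionLaw]
    rw [← key]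
    have hb : Measurable fun ω =>
        (Measure.pi fun i => (c i).law Q fun a => Measure.dirac (f a ω)).bind Q :=
      (Measure.measurable_bind' Q.measurable).comp hpi
    rw [Measure.bind_bind hpi.aemeasurable Q.aemeasurable]
    ext C hC
    rw [Measure.map_apply (measurable_pi_apply 0) hC, Measure.bind_apply hC,
      Measure.bind_apply (measurable_pi_apply 0 hC) hb.aemeasurable]
    · exact lintegral_congr fun ω => Measure.map_apply (measurable_pi_apply 0) hC
    · exact ((Measure.measurable_map _ (measurable_pi_apply 0)).comp hb).aemeasurable

/-- A family of random variables of which at most one is not constant is independent. -/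
theorem iIndepFun_of_const {P : Measure Ω} [IsProbabilityMeasure P] {f : α → Ω → E} (a : α)
    (h : ∀ b, b ≠ a → ∃ x, f b = fun _ => x) : iIndepFun f P := by
  rw [iIndepFun_iff_measure_inter_preimage_eq_mul]
  intro S C _
  -- Either some constant misses its set and both sides vanish, or every index other than `a`
  -- imposes no condition.
  by_cases hS : ∃ b ∈ S, b ≠ a ∧ f b ⁻¹' C b = ∅
  · obtain ⟨b, hb, -, hC⟩ := hS
    rw [Finset.prod_eq_zero hb (by rw [hC, measure_empty])]
    exact measure_mono_null (Set.biInter_subset_of_mem hb) (by rw [hC, measure_empty])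
  · have huniv : ∀ b ∈ S, b ≠ a → f b ⁻¹' C b = Set.univ := by
      intro b hb hba
      obtain ⟨x, hx⟩ := h b hba
      by_cases hxC : x ∈ C b
      · ext ω; simp [hx, hxC]
      · exact absurd ⟨b, hb, hba, by ext ω; simp [hx, hxC]⟩ hS
    by_cases ha : a ∈ S
    · rw [Finset.prod_eq_single_of_mem a ha fun b hb hba => by rw [huniv b hb hba, measure_univ]]
      congr 1
      refine (Set.biInter_subset_of_mem ha).antisymm (Set.subset_iInter₂ fun b hb => ?_)
      by_cases hba : b = a
      · rw [hba]
      · rw [huniv b hb hba]; exact Set.subset_univ _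
    · rw [Finset.prod_eq_one fun b hb => by
        rw [huniv b hb (fun e => ha (e ▸ hb)), measure_univ]]
      rw [Set.iInter₂_congr fun b hb => huniv b hb (fun e => ha (e ▸ hb))]
      simp

end

noncomputable section

variable {E : Type*} [MeasurableSpace E] {m : ℕ}

/-! ### Groups of agents -/

theorem AgentGroup.member_injective {N : ℕ} (G : AgentGroup N m) : Function.Injective G.member :=
  (G.1.orderEmbOfFin G.2).injective

theorem AgentGroup.mem_iff {N : ℕ} (G : AgentGroup N m) (a : Fin N) :
    a ∈ G.1 ↔ ∃ i, G.member i = a := by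
  have h := G.1.range_orderEmbOfFin G.2
  rw [← Finset.mem_coe, ← h]
  rfl

theorem groupKernel_apply {N : ℕ} (Q : Kernel (Fin m → E) (Fin m → E)) [IsMarkovKernel Q]
    (G : AgentGroup N m) (x : Fin N → E) :
    groupKernel Q G x = (Q fun i => x (G.member i)).map (G.replace x) := by
  rw [groupKernel, Kernel.map_apply _ G.measurable_replace, Kernel.prod_apply, Kernel.id_apply,
    Kernel.comap_apply, Measure.dirac_prod, Measure.map_map G.measurable_replace (by fun_prop)]
  rfl

theorem AgentGroup.measurable_replace_right {N : ℕ} (G : AgentGroup N m) (x : Fin N → E) :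
    Measurable (G.replace x) :=
  G.measurable_replace.comp measurable_prodMk_left

/-! ### Counting groups -/

theorem card_groups_disjoint {N : ℕ} (L : Finset (Fin N)) :
    (Finset.univ.filter fun G : AgentGroup N m => Disjoint G.1 L).card = (N - L.card).choose m := by
  have h : (Finset.univ.filter fun G : AgentGroup N m => Disjoint G.1 L).card
      = (Finset.powersetCard m Lᶜ).card := by
    refine Finset.card_bij (fun G _ => G.1) ?_ ?_ ?_
    · intro G hG
      rw [Finset.mem_powersetCard]
      exact ⟨Finset.subset_compl_iff_disjoint_right.2 (Finset.mem_filter.1 hG).2, G.2⟩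
    · intro G _ G' _ e
      exact Subtype.ext e
    · intro S hS
      rw [Finset.mem_powersetCard] at hS
      exact ⟨⟨S, hS.2⟩, Finset.mem_filter.2 ⟨Finset.mem_univ _,
        Finset.subset_compl_iff_disjoint_right.1 hS.1⟩, rfl⟩
  rw [h, Finset.card_powersetCard, Finset.card_compl, Fintype.card_fin]

/-- The only loss is the groups with at least two members in `L`: these are the redundant
interactions. -/
theorem sum_groups_ge {N : ℕ} (L : Finset (Fin N)) (F : AgentGroup N m → ℝ≥0∞) :
    ∑ G with Disjoint G.1 L, F G + ∑ a ∈ L, ∑ G : AgentGroup N m with G.1 ∩ L = {a}, F G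
      ≤ ∑ G, F G := by
  simp_rw [Finset.sum_filter]
  rw [Finset.sum_comm, ← Finset.sum_add_distrib]
  refine Finset.sum_le_sum fun G _ => ?_
  by_cases hd : Disjoint G.1 L
  · rw [if_pos hd, Finset.sum_eq_zero, add_zero]
    intro a _
    rw [if_neg]
    rw [Finset.disjoint_iff_inter_eq_empty.1 hd]
    exact (Finset.singleton_ne_empty a).symm
  · rw [if_neg hd, zero_add]
    by_cases he : ∃ a ∈ L, G.1 ∩ L = {a}
    · obtain ⟨a, ha, hGa⟩ := he
      rw [Finset.sum_eq_single_of_mem a ha, if_pos hGa]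
      intro b _ hb
      rw [if_neg]
      rw [hGa]
      exact fun e => hb (Finset.singleton_injective e).symm
    · rw [Finset.sum_eq_zero]
      · exact zero_le
      · exact fun a ha => if_neg fun h => he ⟨a, ha, h⟩

/-- This frees the sum over grown shapes from the actual labels, which depend on the interacting
group. -/
theorem LTree.shape_graft_congr {α : Type*} [DecidableEq α] (a : α) (e e' : Fin m → α)
    (T : LTree m α) : (T.graft a e).shape = (T.graft a e').shape := by
  induction T with
  | leaf b =>
    by_cases h : b = a <;> simp [graft, h, shape]
  | node c ih => simp only [graft, shape, ih]

variable [NeZero m] {Q : Kernel (Fin m → E) (Fin m → E)}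

theorem card_groups_inter_eq_singleton {N : ℕ} {L : Finset (Fin N)} {a : Fin N} (ha : a ∈ L) :
    (Finset.univ.filter fun G : AgentGroup N m => G.1 ∩ L = {a}).card
      = (N - L.card).choose (m - 1) := by
  have hm : 0 < m := Nat.pos_of_ne_zero (NeZero.ne m)
  have h : (Finset.univ.filter fun G : AgentGroup N m => G.1 ∩ L = {a}).card
      = (Finset.powersetCard (m - 1) Lᶜ).card := by
    have haS : ∀ S ⊆ Lᶜ, a ∉ S := fun S hS h => Finset.mem_compl.1 (hS h) ha
    refine Finset.card_bij (fun G _ => G.1.erase a) ?_ ?_ ?_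
    · intro G hG
      have hG' := (Finset.mem_filter.1 hG).2
      have haG : a ∈ G.1 := (Finset.mem_inter.1 (hG' ▸ Finset.mem_singleton_self a)).1
      rw [Finset.mem_powersetCard, Finset.card_erase_of_mem haG, G.2]
      refine ⟨fun b hb => Finset.mem_compl.2 fun hbL => ?_, rfl⟩
      have : b ∈ G.1 ∩ L := Finset.mem_inter.2 ⟨Finset.mem_of_mem_erase hb, hbL⟩
      rw [hG', Finset.mem_singleton] at this
      exact Finset.ne_of_mem_erase hb this
    · intro G hG G' hG' e
      have haG : ∀ G : AgentGroup N m, G ∈ Finset.univ.filter (fun G => G.1 ∩ L = {a}) →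
          a ∈ G.1 := fun G hG =>
        (Finset.mem_inter.1 ((Finset.mem_filter.1 hG).2 ▸ Finset.mem_singleton_self a)).1
      refine Subtype.ext ?_
      rw [← Finset.insert_erase (haG G hG), ← Finset.insert_erase (haG G' hG'), e]
    · intro S hS
      rw [Finset.mem_powersetCard] at hS
      have haS' := haS S hS.1
      refine ⟨⟨insert a S, by rw [Finset.card_insert_of_notMem haS', hS.2]; omega⟩,
        Finset.mem_filter.2 ⟨Finset.mem_univ _, ?_⟩, Finset.erase_insert haS'⟩
      rw [Finset.insert_inter_of_mem ha,
        Finset.disjoint_iff_inter_eq_empty.1 (Finset.subset_compl_iff_disjoint_right.1 hS.1)]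
      rfl
  rw [h, Finset.card_powersetCard, Finset.card_compl, Fintype.card_fin]

/-! ### One interaction, seen from a labelled tree -/

theorem interactionLaw_dirac (Q : Kernel (Fin m → E) (Fin m → E)) (x : Fin m → E) :
    interactionLaw Q (fun i => Measure.dirac (x i)) = (Q x).map fun y => y 0 := by
  have h : Measure.pi (fun i => Measure.dirac (x i)) = Measure.dirac x := by
    refine Measure.pi_eq fun C hC => ?_
    simp only [Measure.dirac_apply' _ (MeasurableSet.univ_pi hC), Measure.dirac_apply' _ (hC _)]
    by_cases hx : x ∈ Set.univ.pi C
    · rw [Set.indicator_of_mem hx, Finset.prod_eq_one]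
      · rfl
      · intro i _
        rw [Set.indicator_of_mem (hx i (Set.mem_univ i))]
        rfl
    · rw [Set.indicator_of_notMem hx]
      simp only [Set.mem_univ_pi, not_forall] at hx
      obtain ⟨i, hi⟩ := hx
      rw [Finset.prod_eq_zero (Finset.mem_univ i)]
      rw [Set.indicator_of_notMem hi]
  rw [interactionLaw, h, Measure.dirac_bind Q.measurable]

/-- Symmetry enters here: a transposition moves the followed member to the first place, the one read
by `interactionLaw`. -/
theorem IsSymmetricKernel.map_eval (hQ : IsSymmetricKernel Q) (x : Fin m → E) (i : Fin m) :
    (Q x).map (fun y => y i) = (Q fun j => x (Equiv.swap 0 i j)).map fun y => y 0 := by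
  ext C hC
  rw [Measure.map_apply (measurable_pi_apply i) hC, Measure.map_apply (measurable_pi_apply 0) hC]
  have h := hQ (Equiv.swap 0 i) x (Function.update (fun _ => Set.univ) i C) fun j => by
    by_cases hj : j = i
    · subst hj; simpa using hC
    · rw [Function.update_of_ne hj]; exact MeasurableSet.univ
  convert h using 2
  · ext y
    simp only [Set.mem_preimage, Set.mem_univ_pi]
    refine ⟨fun hy j => ?_, fun hy => by simpa using hy i⟩
    by_cases hj : j = i
    · subst hj; simpa using hy
    · simp [hj]
  · ext y
    simp only [Set.mem_preimage, Set.mem_univ_pi]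
    refine ⟨fun hy j => ?_, fun hy => by simpa using hy 0⟩
    by_cases hj : j = 0
    · subst hj; simpa using hy
    · have : Equiv.swap 0 i j ≠ i := by
        intro e
        exact hj ((Equiv.swap 0 i).injective (e.trans (Equiv.swap_apply_left 0 i).symm))
      simp [this]

/-- The law at the root of a labelled tree when the states of a configuration are placed on the
leaves. -/
def LTree.lawAt {N : ℕ} (Q : Kernel (Fin m → E) (Fin m → E)) (T : LTree m (Fin N))
    (x : Fin N → E) : Measure E :=
  T.law Q fun a => Measure.dirac (x a)

theorem LTree.measurable_lawAt {N : ℕ} [IsMarkovKernel Q] (T : LTree m (Fin N)) :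
    Measurable (T.lawAt Q) :=
  T.measurable_law Q (ν := fun a (x : Fin N → E) => Measure.dirac (x a))
    fun a _ => Measure.measurable_dirac.comp (measurable_pi_apply a)

/-- The interaction of a group which has no member but possibly the `i`-th one among the labels of
a tree grafts this group on the tree. -/
theorem bind_groupKernel_lawAt [IsMarkovKernel Q] (hQ : IsSymmetricKernel Q) {N : ℕ}
    (G : AgentGroup N m) (i : Fin m) {T : LTree m (Fin N)} (hT : T.Distinct)
    (h : ∀ j, G.member j ∈ T.labels → j = i) (x : Fin N → E) :
    (groupKernel Q G x).bind (T.lawAt Q)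
      = (T.graft (G.member i) fun j => G.member (Equiv.swap 0 i j)).lawAt Q x := by
  set P := Q fun j => x (G.member j) with hP
  -- After the interaction the tree sees only one new state, that of member `i`; all other labels
  -- keep their deterministic states, so independence is automatic.
  set f : Fin N → (Fin m → E) → E := fun b z => if b = G.member i then z i else x b with hf
  have hfm : ∀ b, Measurable (f b) := by
    intro b
    by_cases hb : b = G.member i
    · simp only [hf, hb, if_true]; fun_prop
    · simp only [hf, hb, if_false]; fun_prop
  have hind : iIndepFun f P :=
    iIndepFun_of_const (G.member i) fun b hb => ⟨x b, by funext z; simp [hf, hb]⟩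
  have hrep : ∀ z, T.lawAt Q (G.replace x z) = T.law Q fun b => Measure.dirac (f b z) := by
    intro z
    refine T.law_congr Q fun b hb => ?_
    congr 1
    by_cases hbG : ∃ j, G.member j = b
    · obtain ⟨j, rfl⟩ := hbG
      obtain rfl := h j hb
      simp [hf, AgentGroup.replace, G.member_injective.extend_apply]
    · have hbi : b ≠ G.member i := fun e => hbG ⟨i, e.symm⟩
      simp [hf, hbi, AgentGroup.replace, Function.extend_apply' _ _ _ hbG]
  have h1 : (groupKernel Q G x).bind (T.lawAt Q)
      = P.bind fun z => T.law Q fun b => Measure.dirac (f b z) := by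
    simp_rw [← hrep]
    rw [groupKernel_apply]
    ext C hC
    have hm1 : Measurable fun z => T.lawAt Q (G.replace x z) :=
      T.measurable_lawAt.comp (G.measurable_replace_right x)
    rw [Measure.bind_apply hC T.measurable_lawAt.aemeasurable,
      Measure.bind_apply hC hm1.aemeasurable]
    exact lintegral_map ((Measure.measurable_coe hC).comp T.measurable_lawAt)
      (G.measurable_replace_right x)
  rw [h1, LTree.bind_law_dirac Q hfm hind hT, LTree.lawAt, LTree.law_graft]
  congr 1
  funext b
  by_cases hb : b = G.member i
  · subst hb
    rw [Function.update_self, interactionLaw_dirac, ← hQ.map_eval (fun j => x (G.member j)) i]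
    simp [hf, hP]
  · rw [Function.update_of_ne hb]
    simp [hf, hb]

/-! ### The agents' system dominates the trees without redundant interactions -/

theorem kacStep_bind_lawAt [IsMarkovKernel Q] {N : ℕ} (ν : Measure (Fin N → E))
    (T : LTree m (Fin N)) {C : Set E} (hC : MeasurableSet C) :
    (kacStep Q ν).bind (T.lawAt Q) C = (N.choose m : ℝ≥0∞)⁻¹ *
      ∑ G : AgentGroup N m, ν.bind (fun x => (groupKernel Q G x).bind (T.lawAt Q)) C := by
  rw [Measure.bind_apply hC T.measurable_lawAt.aemeasurable, kacStep, lintegral_smul_measure,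
    lintegral_finsetSum_measure, smul_eq_mul]
  congr 1
  refine Finset.sum_congr rfl fun G _ => ?_
  rw [← Measure.bind_apply hC T.measurable_lawAt.aemeasurable,
    Measure.bind_bind (groupKernel Q G).aemeasurable T.measurable_lawAt.aemeasurable]

/-- The contribution to `C` of the histories of `k` steps of the Kac walk of `N` agents without
redundant interactions, when the later part of the history is the given tree. -/
def prunedWeight (Q : Kernel (Fin m → E) (Fin m → E)) (μ : Measure E) (C : Set E) (N : ℕ) :
    ℕ → MTree m → ℝ≥0∞
  | 0, T => treeLaw Q μ T C
  | k + 1, T => (N.choose m : ℝ≥0∞)⁻¹ *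
      (((N - T.numLeaves).choose m : ℕ) * prunedWeight Q μ C N k T
        + ((N - T.numLeaves).choose (m - 1) : ℕ) * (T.grow.map (prunedWeight Q μ C N k)).sum)

/-- The induction peels off the last step of the walk, which is the first one met going backwards,
and must therefore cover every distinctly labelled tree. -/
theorem prunedWeight_le [IsMarkovKernel Q] (hQ : IsSymmetricKernel Q) (μ : Measure E)
    [IsProbabilityMeasure μ] {C : Set E} (hC : MeasurableSet C) {N : ℕ} (k : ℕ)
    {T : LTree m (Fin N)} (hT : T.Distinct) :
    prunedWeight Q μ C N k T.shape
      ≤ ((kacStep Q)^[k] (Measure.pi fun _ => μ)).bind (T.lawAt Q) C := by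
  induction k generalizing T with
  | zero =>
    have h := LTree.bind_law_dirac Q (P := Measure.pi fun _ : Fin N => μ)
      (f := fun a x => x a) (fun a => measurable_pi_apply a)
      (iIndepFun_pi (X := fun _ x => x) fun _ => aemeasurable_id') hT
    have h2 : ∀ a : Fin N, (Measure.pi fun _ : Fin N => μ).map (fun x => x a) = μ := fun a =>
      (measurePreserving_eval (fun _ : Fin N => μ) a).map_eq
    simp_rw [h2] at h
    rw [LTree.law_const] at h
    rw [prunedWeight, ← h]
    rfl
  | succ k ih =>
    rw [Function.iterate_succ', Function.comp_apply, kacStep_bind_lawAt _ _ hC, prunedWeight]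
    gcongr
    refine le_trans ?_ (sum_groups_ge T.labels _)
    rw [← LTree.card_labels hT]
    gcongr
    · rw [← card_groups_disjoint T.labels, ← nsmul_eq_mul]
      refine Finset.card_nsmul_le_sum _ _ _ fun G hG => ?_
      have hG' := (Finset.mem_filter.1 hG).2
      have hmem : ∀ j, G.member j ∉ T.labels := fun j hj =>
        Finset.disjoint_left.1 hG' ((G.mem_iff _).2 ⟨j, rfl⟩) hj
      -- The index `0` is arbitrary: no member is a label, so the graft changes nothing.
      simp_rw [bind_groupKernel_lawAt hQ G 0 hT (fun j hj => absurd hj (hmem j))]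
      rw [LTree.graft_of_notMem _ (hmem 0)]
      exact ih hT
    · rw [← LTree.sum_shape_graft _ hT fun a _ => a, Finset.mul_sum]
      refine Finset.sum_le_sum fun a ha => ?_
      rw [← card_groups_inter_eq_singleton (m := m) ha, ← nsmul_eq_mul]
      refine Finset.card_nsmul_le_sum _ _ _ fun G hG => ?_
      have hG' := (Finset.mem_filter.1 hG).2
      have haG : a ∈ G.1 := (Finset.mem_inter.1 (hG' ▸ Finset.mem_singleton_self a)).1
      obtain ⟨i, rfl⟩ := (G.mem_iff a).1 haG
      have hmem : ∀ j, G.member j ∈ T.labels → G.member j = G.member i := fun j hj => by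
        have := Finset.mem_inter.2 ⟨(G.mem_iff _).2 ⟨j, rfl⟩, hj⟩
        rwa [hG', Finset.mem_singleton] at this
      simp_rw [bind_groupKernel_lawAt hQ G i hT fun j hj => G.member_injective (hmem j hj)]
      rw [LTree.shape_graft_congr _ _ fun j => G.member (Equiv.swap 0 i j)]
      exact ih (hT.graft (G.member_injective.comp (Equiv.injective _)) fun j hj => hmem _ hj)

/-! ### Averaging over `𝔸_n` and duality with the killed chain -/

/-- The probability that none of the `(m-1)n+1` agents takes part in the next interaction. -/
def stayProb (m N n : ℕ) : ℝ := ((N - ((m - 1) * n + 1)).choose m : ℕ) / (N.choose m : ℕ)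

/-- The probability that exactly one of the `(m-1)n+1` agents takes part in the next interaction. -/
def jumpProb (m N n : ℕ) : ℝ :=
  ((m - 1) * n + 1 : ℕ) * ((N - ((m - 1) * n + 1)).choose (m - 1) : ℕ) / (N.choose m : ℕ)

theorem stayProb_nonneg (m N n : ℕ) : 0 ≤ stayProb m N n := by unfold stayProb; positivity

theorem jumpProb_nonneg (m N n : ℕ) : 0 ≤ jumpProb m N n := by unfold jumpProb; positivity

/-- All trees of `𝔸_n` have the same number of leaves, so the binomial coefficients factor out, and
growing them enumerates `𝔸_{n+1}`. -/
theorem sum_prunedWeight_trees_succ (Q : Kernel (Fin m → E) (Fin m → E)) (μ : Measure E) (C : Set E)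
    (N k n : ℕ) : ((trees m n).map (prunedWeight Q μ C N (k + 1))).sum
      = (N.choose m : ℝ≥0∞)⁻¹ *
        (((N - ((m - 1) * n + 1)).choose m : ℕ) * ((trees m n).map (prunedWeight Q μ C N k)).sum
          + ((N - ((m - 1) * n + 1)).choose (m - 1) : ℕ)
            * ((trees m (n + 1)).map (prunedWeight Q μ C N k)).sum) := by
  have hm : 1 ≤ m := Nat.pos_of_ne_zero (NeZero.ne m)
  rw [trees, Multiset.map_bind, Multiset.sum_bind, ← Multiset.sum_map_mul_left,
    ← Multiset.sum_map_mul_left, ← Multiset.sum_map_add, ← Multiset.sum_map_mul_left]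
  congr 1
  refine Multiset.map_congr rfl fun T hT => ?_
  rw [prunedWeight, numLeaves_of_mem_trees hm n T hT]

/-- The average of `prunedWeight` over `𝔸_n`. -/
def meanPrunedWeight (Q : Kernel (Fin m → E) (Fin m → E)) (μ : Measure E) (C : Set E)
    (N k n : ℕ) : ℝ≥0∞ :=
  (numTrees m n : ℝ≥0∞)⁻¹ * ((trees m n).map (prunedWeight Q μ C N k)).sum

theorem meanPrunedWeight_succ (Q : Kernel (Fin m → E) (Fin m → E)) (μ : Measure E) (C : Set E)
    {N : ℕ} (hN : m ≤ N) (k n : ℕ) : meanPrunedWeight Q μ C N (k + 1) n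
      = ENNReal.ofReal (stayProb m N n) * meanPrunedWeight Q μ C N k n
        + ENNReal.ofReal (jumpProb m N n) * meanPrunedWeight Q μ C N k (n + 1) := by
  have hc : (0 : ℝ) < (N.choose m : ℕ) := by exact_mod_cast Nat.choose_pos hN
  have h1 : (numTrees m n : ℝ≥0∞) ≠ 0 := by exact_mod_cast (numTrees_pos m n).ne'
  have h2 : (((m - 1) * n + 1 : ℕ) : ℝ≥0∞) ≠ 0 := by
    exact_mod_cast Nat.succ_ne_zero ((m - 1) * n)
  have e : ((numTrees m (n + 1) : ℕ) : ℝ≥0∞)⁻¹ * ((m - 1) * n + 1 : ℕ)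
      = (numTrees m n : ℝ≥0∞)⁻¹ := by
    rw [numTrees_succ, Nat.cast_mul, ENNReal.mul_inv (Or.inl h1) (Or.inl (ENNReal.natCast_ne_top _)),
      mul_assoc, ENNReal.inv_mul_cancel h2 (ENNReal.natCast_ne_top _), mul_one]
  rw [meanPrunedWeight, sum_prunedWeight_trees_succ, stayProb, jumpProb,
    ENNReal.ofReal_div_of_pos hc, ENNReal.ofReal_div_of_pos hc, ← Nat.cast_mul,
    ENNReal.ofReal_natCast, ENNReal.ofReal_natCast, ENNReal.ofReal_natCast, meanPrunedWeight,
    meanPrunedWeight, ← e, Nat.cast_mul, div_eq_mul_inv, div_eq_mul_inv]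
  rw [e]
  conv_lhs => rw [mul_add, mul_add]
  congr 1
  · ring
  · rw [← e]; ring

/-- Adjointness of the chain: a forward step of its law is traded for a backward step of the
weights. -/
theorem tsum_killedChain_mul_meanPrunedWeight (Q : Kernel (Fin m → E) (Fin m → E)) (μ : Measure E)
    (C : Set E) {N : ℕ} (hN : m ≤ N) (i k : ℕ) :
    ∑' n, ENNReal.ofReal (killedChain (stayProb m N) (jumpProb m N) (i + 1) n)
        * meanPrunedWeight Q μ C N k n
      = ∑' n, ENNReal.ofReal (killedChain (stayProb m N) (jumpProb m N) i n)
        * meanPrunedWeight Q μ C N (k + 1) n := by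
  have hs := stayProb_nonneg m N
  have hj := jumpProb_nonneg m N
  have hk := fun n => killedChain_nonneg hs hj i n
  simp_rw [meanPrunedWeight_succ Q μ C hN, mul_add]
  rw [ENNReal.tsum_add, tsum_eq_zero_add' ENNReal.summable]
  conv_rhs => rw [tsum_eq_zero_add' ENNReal.summable]
  rw [add_assoc, ← ENNReal.tsum_add]
  congr 1
  · rw [killedChain, ENNReal.ofReal_mul (hs 0)]
    ring
  · refine tsum_congr fun n => ?_
    rw [killedChain, ENNReal.ofReal_add (mul_nonneg (hs _) (hk _)) (mul_nonneg (hj _) (hk _)),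
      ENNReal.ofReal_mul (hs _), ENNReal.ofReal_mul (hj _)]
    ring

theorem tsum_killedChain_zero (s j : ℕ → ℝ) (v : ℕ → ℝ≥0∞) :
    ∑' n, ENNReal.ofReal (killedChain s j 0 n) * v n = v 0 := by
  rw [tsum_eq_single 0]
  · simp [killedChain]
  · intro n hn; simp [killedChain, hn]

theorem meanTreeLaw_apply (Q : Kernel (Fin m → E) (Fin m → E)) (μ : Measure E) (N n : ℕ)
    (C : Set E) : meanTreeLaw Q μ n C = meanPrunedWeight Q μ C N 0 n := by
  rw [meanTreeLaw, Measure.smul_apply, smul_eq_mul, meanPrunedWeight]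
  congr 1
  induction trees m n using Multiset.induction_on with
  | empty => simp
  | cons T s ih => simp [ih, prunedWeight]

theorem tsum_killedChain_mul_meanTreeLaw (Q : Kernel (Fin m → E) (Fin m → E)) (μ : Measure E)
    (C : Set E) {N : ℕ} (hN : m ≤ N) (k : ℕ) :
    ∑' n, ENNReal.ofReal (killedChain (stayProb m N) (jumpProb m N) k n) * meanTreeLaw Q μ n C
      = prunedWeight Q μ C N k .leaf := by
  -- The pairing depends only on `i + k`; at `i = 0` the chain sits on the single tree of `𝔸_0`.
  have h : ∀ i k, ∑' n, ENNReal.ofReal (killedChain (stayProb m N) (jumpProb m N) i n)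
      * meanPrunedWeight Q μ C N k n = prunedWeight Q μ C N (i + k) .leaf := by
    intro i
    induction i with
    | zero =>
      intro k
      rw [tsum_killedChain_zero, zero_add]
      simp [meanPrunedWeight, numTrees, trees]
    | succ i ih =>
      intro k
      rw [tsum_killedChain_mul_meanPrunedWeight Q μ C hN, ih]
      congr 1
      omega
  simp_rw [meanTreeLaw_apply Q μ N]
  exact h k 0

end

noncomputable section

/-! ### Intensities for many agents -/

/-- Adding the `l` elements one at a time by Pascal's rule, each adds between `M.choose p` and `(M +
l - 1).choose p`. -/
theorem choose_add_bounds (M l p : ℕ) :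
    M.choose (p + 1) + l * M.choose p ≤ (M + l).choose (p + 1) ∧
      (M + l).choose (p + 1) ≤ M.choose (p + 1) + l * (M + l - 1).choose p := by
  induction l with
  | zero => simp
  | succ l ih =>
    rw [← Nat.add_assoc, Nat.choose_succ_succ, Nat.add_sub_cancel]
    have h1 : M.choose p ≤ (M + l).choose p := Nat.choose_le_choose p (Nat.le_add_right M l)
    have h2 : l * (M + l - 1).choose p ≤ l * (M + l).choose p :=
      Nat.mul_le_mul_left l (Nat.choose_le_choose p (Nat.sub_le _ 1))
    constructor <;> nlinarith [ih.1, ih.2]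

theorem jumpProb_le_one_sub_stayProb {m N : ℕ} (hm : 2 ≤ m) (hN : m ≤ N) (n : ℕ) :
    jumpProb m N n ≤ 1 - stayProb m N n := by
  obtain ⟨p, rfl⟩ : ∃ p, m = p + 1 := ⟨m - 1, by omega⟩
  have hc : (0 : ℝ) < (N.choose (p + 1) : ℕ) := by exact_mod_cast Nat.choose_pos hN
  unfold jumpProb stayProb
  set l := (p + 1 - 1) * n + 1
  rw [le_sub_iff_add_le, ← add_div, div_le_one hc]
  by_cases hl : l ≤ N
  · have h := (choose_add_bounds (N - l) l p).1
    rw [Nat.sub_add_cancel hl] at h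
    rw [Nat.add_sub_cancel]
    exact_mod_cast (by linarith : l * (N - l).choose p + (N - l).choose (p + 1) ≤ N.choose (p + 1))
  -- Truncated subtraction gives `0` here, and `m ≥ 2` is needed to make `Nat.choose 0 (m - 1)`
  -- vanish.
  · rw [Nat.sub_eq_zero_of_le (by omega : N ≤ l), Nat.choose_eq_zero_of_lt (by omega),
      Nat.choose_eq_zero_of_lt (by omega)]
    simp

theorem treeIntensity_eq_mul_jumpProb (m : ℕ) (lam : ℝ) (N n : ℕ) :
    treeIntensity m lam N n = lam * (N / m) * jumpProb m N n := by
  unfold treeIntensity jumpProb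
  ring

theorem treeIntensity_nonneg (m : ℕ) {lam : ℝ} (hl : 0 ≤ lam) (N n : ℕ) :
    0 ≤ treeIntensity m lam N n := by
  unfold treeIntensity
  positivity

theorem mul_choose_sub_one {m N : ℕ} (hm : 1 ≤ m) (hN : 1 ≤ N) :
    N * (N - 1).choose (m - 1) = N.choose m * m := by
  obtain ⟨p, rfl⟩ : ∃ p, m = p + 1 := ⟨m - 1, by omega⟩
  obtain ⟨M, rfl⟩ : ∃ M, N = M + 1 := ⟨N - 1, by omega⟩
  exact Nat.add_one_mul_choose_eq M p

theorem div_div_choose {m N : ℕ} (hm : 1 ≤ m) (hN : m ≤ N) :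
    (N : ℝ) / m / (N.choose m : ℕ) = 1 / ((N - 1).choose (m - 1) : ℕ) := by
  have hc : (0 : ℝ) < (N.choose m : ℕ) := by exact_mod_cast Nat.choose_pos hN
  have hc' : (0 : ℝ) < ((N - 1).choose (m - 1) : ℕ) := by
    exact_mod_cast Nat.choose_pos (by omega)
  have hm' : (0 : ℝ) < m := by exact_mod_cast hm
  have h : (N : ℝ) * ((N - 1).choose (m - 1) : ℕ) = (N.choose m : ℕ) * m := by
    exact_mod_cast mul_choose_sub_one hm (by omega)
  rw [div_div, div_eq_div_iff (by positivity) (by positivity)]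
  linarith

/-- Excluding `l - 1` of `N - 1` agents loses at most a fraction `(l - 1)p/(N - 1)` of the choices.
-/
theorem tendsto_choose_sub_div_choose {l p : ℕ} (hl : 1 ≤ l) (hp : 1 ≤ p) :
    Tendsto (fun N : ℕ => (((N - l).choose p : ℕ) : ℝ) / ((N - 1).choose p : ℕ)) atTop (𝓝 1) := by
  have h0 : Tendsto (fun N : ℕ => 1 - ((l - 1 : ℕ) * p : ℝ) / ((N - 1 : ℕ) : ℝ)) atTop (𝓝 1) := by
    have h := (tendsto_const_div_atTop_nhds_zero_nat ((l - 1 : ℕ) * p : ℝ)).comp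
      (tendsto_sub_atTop_nat 1)
    simpa using h.const_sub 1
  refine tendsto_of_tendsto_of_tendsto_of_le_of_le' h0 tendsto_const_nhds ?_ ?_
  · filter_upwards [eventually_ge_atTop (l + p + 1)] with N hN
    obtain ⟨q, rfl⟩ : ∃ q, p = q + 1 := ⟨p - 1, by omega⟩
    have hc : (0 : ℝ) < ((N - 1).choose (q + 1) : ℕ) := by
      exact_mod_cast Nat.choose_pos (by omega)
    have h1 := (choose_add_bounds (N - l) (l - 1) q).2
    rw [show N - l + (l - 1) = N - 1 by omega] at h1
    have h2 : (N - 1) * (N - 1 - 1).choose q = (N - 1).choose (q + 1) * (q + 1) :=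
      mul_choose_sub_one (m := q + 1) (by omega) (by omega)
    have hN1 : (0 : ℝ) < ((N - 1 : ℕ) : ℝ) := by exact_mod_cast (by omega : 0 < N - 1)
    have h1' : (((N - 1).choose (q + 1) : ℕ) : ℝ)
        ≤ ((N - l).choose (q + 1) : ℕ) + (l - 1 : ℕ) * ((N - 1 - 1).choose q : ℕ) := by
      exact_mod_cast h1
    have h2' : ((N - 1 : ℕ) : ℝ) * ((N - 1 - 1).choose q : ℕ)
        = ((N - 1).choose (q + 1) : ℕ) * ((q + 1 : ℕ) : ℝ) := by exact_mod_cast h2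
    rw [le_div_iff₀ hc]
    have h3 : ((N - 1 - 1).choose q : ℝ)
        = ((N - 1).choose (q + 1) : ℕ) * ((q + 1 : ℕ) : ℝ) / ((N - 1 : ℕ) : ℝ) := by
      rw [eq_div_iff hN1.ne', ← h2']; ring
    rw [h3] at h1'
    calc (1 - ((l - 1 : ℕ) : ℝ) * ((q + 1 : ℕ) : ℝ) / ((N - 1 : ℕ) : ℝ))
          * ((N - 1).choose (q + 1) : ℕ)
        = ((N - 1).choose (q + 1) : ℕ) - (l - 1 : ℕ) *
          (((N - 1).choose (q + 1) : ℕ) * ((q + 1 : ℕ) : ℝ) / ((N - 1 : ℕ) : ℝ)) := by ring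
      _ ≤ _ := by linarith
  · refine Eventually.of_forall fun N => div_le_one_of_le₀ ?_ (Nat.cast_nonneg _)
    exact_mod_cast Nat.choose_le_choose p (by omega : N - l ≤ N - 1)

theorem tendsto_treeIntensity {m : ℕ} (hm : 2 ≤ m) (lam : ℝ) (n : ℕ) :
    Tendsto (fun N => treeIntensity m lam N n) atTop (𝓝 (lam * ((m - 1) * n + 1 : ℕ))) := by
  have h := (tendsto_choose_sub_div_choose (l := (m - 1) * n + 1) (p := m - 1)
    (by omega) (by omega)).const_mul (lam * ((m - 1) * n + 1 : ℕ))
  rw [mul_one] at h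
  refine h.congr' ?_
  filter_upwards [eventually_ge_atTop m] with N hN
  have e := div_div_choose (m := m) (by omega) hN
  rw [treeIntensity, div_eq_mul_one_div _ (((N - 1).choose (m - 1) : ℕ) : ℝ), ← e]
  ring

/-- The leaving rate lies between `λ_{N,n}` and the union bound `λ((m-1)n+1)`, as each agent
interacts at rate `λ`. Hence the killing rate tends to zero. -/
theorem tendsto_leaveIntensity {m : ℕ} (hm : 2 ≤ m) {lam : ℝ} (hl : 0 ≤ lam) (n : ℕ) :
    Tendsto (fun N : ℕ => lam * (N / m) * (1 - stayProb m N n)) atTop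
      (𝓝 (lam * ((m - 1) * n + 1 : ℕ))) := by
  refine tendsto_of_tendsto_of_tendsto_of_le_of_le' (tendsto_treeIntensity hm lam n)
    tendsto_const_nhds ?_ ?_
  · filter_upwards [eventually_ge_atTop m] with N hN
    rw [treeIntensity_eq_mul_jumpProb]
    exact mul_le_mul_of_nonneg_left (jumpProb_le_one_sub_stayProb hm hN n) (by positivity)
  · filter_upwards [eventually_ge_atTop m, eventually_ge_atTop ((m - 1) * n + 1)] with N hN hlN
    have e := div_div_choose (m := m) (by omega) hN
    obtain ⟨p, rfl⟩ : ∃ p, m = p + 1 := ⟨m - 1, by omega⟩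
    have hc : (0 : ℝ) < (N.choose (p + 1) : ℕ) := by exact_mod_cast Nat.choose_pos hN
    have hc' : (0 : ℝ) < ((N - 1).choose (p + 1 - 1) : ℕ) := by
      exact_mod_cast Nat.choose_pos (by omega)
    unfold stayProb
    set l := (p + 1 - 1) * n + 1
    have h := (choose_add_bounds (N - l) l p).2
    rw [Nat.sub_add_cancel hlN] at h
    have h' : ((N.choose (p + 1) : ℕ) : ℝ)
        ≤ ((N - l).choose (p + 1) : ℕ) + l * ((N - 1).choose p : ℕ) := by exact_mod_cast h
    rw [mul_assoc]
    refine mul_le_mul_of_nonneg_left ?_ hl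
    calc (N : ℝ) / (p + 1 : ℕ) * (1 - ((N - l).choose (p + 1) : ℕ) / (N.choose (p + 1) : ℕ))
        = (N : ℝ) / (p + 1 : ℕ) / (N.choose (p + 1) : ℕ)
          * ((N.choose (p + 1) : ℕ) - ((N - l).choose (p + 1) : ℕ)) := by field_simp
      _ ≤ 1 / ((N - 1).choose (p + 1 - 1) : ℕ) * (l * ((N - 1).choose (p + 1 - 1) : ℕ)) := by
          rw [e]
          refine mul_le_mul_of_nonneg_left ?_ (by positivity)
          rw [Nat.add_sub_cancel]
          linarith
      _ = l := by field_simp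

theorem tsum_ofReal_branchingProb {m : ℕ} (hm : 2 ≤ m) (lam t : ℝ≥0) :
    ∑' n, ENNReal.ofReal (branchingProb m lam t n) = 1 := by
  have h := hasSum_branchingProb hm lam.coe_nonneg t.coe_nonneg
  rw [← ENNReal.ofReal_tsum_of_nonneg (fun n => ?_) h.summable]
  · exact (congrArg ENNReal.ofReal h.tsum_eq).trans ENNReal.ofReal_one
  · rw [branchingProb_eq_birthProb hm]
    exact killedBirthProb_nonneg _ (fun n => mul_nonneg lam.coe_nonneg (Nat.cast_nonneg _)) n t.coe_nonneg

/-! ### The law of the tagged agent -/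

variable {E : Type*} [MeasurableSpace E] {m : ℕ}

/-- Equality fails for `N < m`, where the sum over groups is empty and the step gives the zero
measure. -/
theorem kacStep_univ_le (Q : Kernel (Fin m → E) (Fin m → E)) [IsMarkovKernel Q] {N : ℕ} (ν : Measure (Fin N → E)) :
    kacStep Q ν Set.univ ≤ ν Set.univ := by
  have h : ∀ G : AgentGroup N m, ν.bind (groupKernel Q G) Set.univ = ν Set.univ := by
    intro G
    rw [Measure.bind_apply MeasurableSet.univ (groupKernel Q G).aemeasurable]
    have : ∀ x, groupKernel Q G x Set.univ = 1 := fun x => by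
      rw [groupKernel_apply, Measure.map_apply (G.measurable_replace_right x) MeasurableSet.univ]
      simp
    simp [this]
  rw [kacStep, Measure.smul_apply, Measure.finsetSum_apply, Finset.sum_congr rfl fun G _ => h G,
    Finset.sum_const, Finset.card_univ, Fintype.card_finset_len, Fintype.card_fin, smul_eq_mul,
    nsmul_eq_mul, ← mul_assoc]
  exact mul_le_of_le_one_left' (ENNReal.inv_mul_le_one _)

theorem agentLaw_apply (Q : Kernel (Fin m → E) (Fin m → E)) (μ : Measure E) (lam t : ℝ≥0) {N : ℕ}
    (P : Fin N) {C : Set E} (hC : MeasurableSet C) :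
    agentLaw Q μ lam t N P C = ∑' k : ℕ,
      ENNReal.ofReal (Real.exp (-(lam * (N / m) * t)) * (lam * (N / m) * t) ^ k / k.factorial)
        * (kacStep Q)^[k] (Measure.pi fun _ => μ) ((fun x => x P) ⁻¹' C) := by
  have hP : Measurable fun x : Fin N → E => x P := measurable_pi_apply P
  rw [agentLaw, systemLaw, Measure.map_apply hP hC,
    Measure.bind_apply (hP hC) (measurable_of_countable _).aemeasurable, poissonMeasure,
    lintegral_sum_measure]
  refine tsum_congr fun k => ?_
  rw [lintegral_smul_measure, lintegral_dirac, smul_eq_mul]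
  push_cast
  rfl

theorem agentLaw_univ_le (Q : Kernel (Fin m → E) (Fin m → E)) [IsMarkovKernel Q] (μ : Measure E) [IsProbabilityMeasure μ] (lam t : ℝ≥0) {N : ℕ}
    (P : Fin N) : agentLaw Q μ lam t N P Set.univ ≤ 1 := by
  have h : ∀ k, (kacStep Q)^[k] (Measure.pi fun _ : Fin N => μ) Set.univ ≤ 1 := by
    intro k
    induction k with
    | zero => simp
    | succ k ih =>
      rw [Function.iterate_succ', Function.comp_apply]
      exact (kacStep_univ_le Q _).trans ih
  rw [agentLaw, Measure.map_apply (measurable_pi_apply P) MeasurableSet.univ, Set.preimage_univ,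
    systemLaw, Measure.bind_apply MeasurableSet.univ (measurable_of_countable _).aemeasurable]
  exact (lintegral_mono h).trans (by simp)

/-! ### Convergence to a mixture of tree laws -/

variable [NeZero m]

theorem treeMixture_apply (Q : Kernel (Fin m → E) (Fin m → E)) (μ : Measure E) (p : ℕ → ℝ)
    {C : Set E} (hC : MeasurableSet C) :
    treeMixture Q μ p C = ∑' n, ENNReal.ofReal (p n) * meanTreeLaw Q μ n C := by
  rw [treeMixture, Measure.sum_apply _ hC]
  rfl

theorem meanTreeLaw_univ (Q : Kernel (Fin m → E) (Fin m → E)) [IsMarkovKernel Q] (μ : Measure E)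
    [IsProbabilityMeasure μ] (n : ℕ) : meanTreeLaw Q μ n Set.univ = 1 := by
  have h : ∀ s : Multiset (MTree m), (s.map (treeLaw Q μ)).sum Set.univ = s.card := by
    intro s
    induction s using Multiset.induction_on with
    | empty => simp
    | cons T s ih => simp [ih, add_comm]
  rw [meanTreeLaw, Measure.smul_apply, h, card_trees (Nat.pos_of_ne_zero (NeZero.ne m)), smul_eq_mul]
  exact ENNReal.inv_mul_cancel (by exact_mod_cast (numTrees_pos m n).ne')
    (ENNReal.natCast_ne_top _)

theorem treeMixture_univ (Q : Kernel (Fin m → E) (Fin m → E)) [IsMarkovKernel Q] (μ : Measure E)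
    [IsProbabilityMeasure μ] (p : ℕ → ℝ) :
    treeMixture Q μ p Set.univ = ∑' n, ENNReal.ofReal (p n) := by
  simp [treeMixture_apply Q μ p MeasurableSet.univ, meanTreeLaw_univ]

/-- Fatou's lemma for mixtures of tree laws. -/
theorem treeMixture_le_liminf (Q : Kernel (Fin m → E) (Fin m → E)) (μ : Measure E) {p : ℕ → ℝ}
    {pN : ℕ → ℕ → ℝ} (hp : ∀ n, Tendsto (fun N => pN N n) atTop (𝓝 (p n)))
    {C : Set E} (hC : MeasurableSet C) {a : ℕ → ℝ≥0∞}
    (ha : ∀ᶠ N in atTop, treeMixture Q μ (pN N) C ≤ a N)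
    (hfin : ∀ n, meanTreeLaw Q μ n C ≠ ∞) :
    treeMixture Q μ p C ≤ liminf a atTop := by
  -- Finite partial sums of the mixture converge, and each is a lower bound for the whole.
  rw [treeMixture_apply Q μ p hC, ENNReal.tsum_eq_iSup_sum]
  refine iSup_le fun s => ?_
  have h : Tendsto (fun N => ∑ n ∈ s, ENNReal.ofReal (pN N n) * meanTreeLaw Q μ n C) atTop
      (𝓝 (∑ n ∈ s, ENNReal.ofReal (p n) * meanTreeLaw Q μ n C)) :=
    tendsto_finsetSum s fun n _ => ENNReal.Tendsto.mul_const
      ((ENNReal.continuous_ofReal.tendsto _).comp (hp n)) (Or.inr (hfin n))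
  rw [← h.liminf_eq]
  refine liminf_le_liminf ?_
  filter_upwards [ha] with N hN
  refine le_trans ?_ hN
  rw [treeMixture_apply Q μ _ hC]
  exact ENNReal.sum_le_tsum s

/-- Measures of mass at most one which dominate mixtures of tree laws whose weights converge to a
probability converge to the limiting mixture. -/
theorem tendsto_treeMixture (Q : Kernel (Fin m → E) (Fin m → E)) [IsMarkovKernel Q] (μ : Measure E)
    [IsProbabilityMeasure μ] {p : ℕ → ℝ} (hsum : ∑' n, ENNReal.ofReal (p n) = 1)
    {pN : ℕ → ℕ → ℝ} (hp : ∀ n, Tendsto (fun N => pN N n) atTop (𝓝 (p n))) {ρ : ℕ → Measure E}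
    (hρ : ∀ N, ρ N Set.univ ≤ 1)
    (hle : ∀ᶠ N in atTop, ∀ C, MeasurableSet C → treeMixture Q μ (pN N) C ≤ ρ N C)
    {C : Set E} (hC : MeasurableSet C) :
    Tendsto (fun N => ρ N C) atTop (𝓝 (treeMixture Q μ p C)) := by
  have hfin : ∀ n C, meanTreeLaw Q μ n C ≠ ∞ := fun n C =>
    ne_top_of_le_ne_top ENNReal.one_ne_top
      ((measure_mono (Set.subset_univ C)).trans (meanTreeLaw_univ Q μ n).le)
  have hlim : ∀ C, MeasurableSet C → treeMixture Q μ p C ≤ liminf (fun N => ρ N C) atTop :=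
    fun C hC => treeMixture_le_liminf Q μ hp hC (hle.mono fun N h => h C hC) fun n => hfin n C
  refine tendsto_of_le_liminf_of_limsup_le (hlim C hC) ?_
  have hone : treeMixture Q μ p C + treeMixture Q μ p Cᶜ = 1 := by
    rw [measure_add_measure_compl hC, treeMixture_univ, hsum]
  have hne : treeMixture Q μ p Cᶜ ≠ ∞ :=
    ne_top_of_le_ne_top ENNReal.one_ne_top (hone ▸ le_add_self)
  -- The lower bound on the complement becomes an upper bound on `C`, and it is sharp because the
  -- limiting mixture has mass one.
  calc limsup (fun N => ρ N C) atTop ≤ limsup (fun N => 1 - ρ N Cᶜ) atTop := by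
        refine limsup_le_limsup (Eventually.of_forall fun N => ?_)
        have h : ρ N C + ρ N Cᶜ ≤ 1 := (measure_add_measure_compl hC).trans_le (hρ N)
        exact ENNReal.le_sub_of_add_le_right
          (ne_top_of_le_ne_top ENNReal.one_ne_top (le_add_self.trans h)) h
    _ = 1 - liminf (fun N => ρ N Cᶜ) atTop := ENNReal.limsup_const_sub _ _ ENNReal.one_ne_top
    _ ≤ 1 - treeMixture Q μ p Cᶜ := tsub_le_tsub_left (hlim _ hC.compl) 1
    _ = treeMixture Q μ p C := by rw [← hone, ENNReal.add_sub_cancel_right hne]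

/-! ### Convergence of the law of the tagged agent -/

variable {Q : Kernel (Fin m → E) (Fin m → E)} [IsMarkovKernel Q]

/-- The law of the tagged agent dominates the contribution of the histories without redundant
interactions. -/
theorem treeMixture_le_agentLaw (hm : 2 ≤ m) (hQ : IsSymmetricKernel Q) (μ : Measure E)
    [IsProbabilityMeasure μ] (lam t : ℝ≥0) {N : ℕ} (hN : m ≤ N) (P : Fin N) {C : Set E}
    (hC : MeasurableSet C) :
    treeMixture Q μ (fun n => killedBirthProb (treeIntensity m lam N)
      (fun n => lam * (N / m) * (1 - stayProb m N n)) n t) C ≤ agentLaw Q μ lam t N P C := by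
  have hs := stayProb_nonneg m N
  have hj := jumpProb_nonneg m N
  have hsj : ∀ n, stayProb m N n + jumpProb m N n ≤ 1 := fun n => by
    linarith [jumpProb_le_one_sub_stayProb hm hN n]
  have hπ := killedChain_nonneg hs hj
  have hrate : treeIntensity m lam N = fun n => (lam : ℝ) * (N / m) * jumpProb m N n :=
    funext fun n => treeIntensity_eq_mul_jumpProb m lam N n
  rw [treeMixture_apply _ _ _ hC, agentLaw_apply _ _ _ _ _ hC, hrate]
  simp_rw [← poissonMean_killedChain hs hj hsj]
  set x : ℝ := lam * (N / m) * t
  have hx : 0 ≤ x := by positivity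
  have hmean : ∀ n, ENNReal.ofReal
      (poissonMean (fun k => killedChain (stayProb m N) (jumpProb m N) k n) x)
      = ∑' k : ℕ, ENNReal.ofReal (Real.exp (-x) * x ^ k / k.factorial)
        * ENNReal.ofReal (killedChain (stayProb m N) (jumpProb m N) k n) := by
    intro n
    have hw : ∀ k : ℕ, 0 ≤ Real.exp (-x) * x ^ k / k.factorial := fun k => by positivity
    rw [poissonMean, ENNReal.ofReal_tsum_of_nonneg]
    · exact tsum_congr fun k => ENNReal.ofReal_mul (hw k)
    · exact fun k => mul_nonneg (hw k) (hπ k n)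
    · refine ((summable_pow_div_factorial_mul (B := 1) (fun k =>
        abs_killedChain_le_one hs hj hsj k n) x).mul_left (Real.exp (-x))).congr fun k => ?_
      ring
  simp_rw [hmean, ← ENNReal.tsum_mul_right]
  rw [ENNReal.tsum_comm]
  refine ENNReal.tsum_le_tsum fun k => ?_
  simp_rw [mul_assoc]
  rw [ENNReal.tsum_mul_left, tsum_killedChain_mul_meanTreeLaw Q μ C hN]
  gcongr
  -- At time `t` the tree is the single leaf `P`, whose law at a configuration is the Dirac mass at
  -- the state of `P`.
  have h := prunedWeight_le hQ μ hC k (T := LTree.leaf P) trivial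
  have hlaw : (LTree.leaf P : LTree m (Fin N)).lawAt Q = fun x => Measure.dirac (x P) := rfl
  rw [hlaw, Measure.bind_dirac_eq_map _ (measurable_pi_apply P),
    Measure.map_apply (measurable_pi_apply P) hC] at h
  exact h

theorem tendsto_agentLaw (hm : 2 ≤ m) (hQ : IsSymmetricKernel Q) (μ : Measure E)
    [IsProbabilityMeasure μ] (lam t : ℝ≥0) (P : (N : ℕ) → Fin (N + 1)) {C : Set E}
    (hC : MeasurableSet C) :
    Tendsto (fun N => agentLaw Q μ lam t (N + 1) (P N) C) atTop
      (𝓝 (extendedWildSum Q μ lam t C)) := by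
  refine tendsto_treeMixture Q μ (tsum_ofReal_branchingProb hm lam t)
    (pN := fun N n => killedBirthProb (treeIntensity m lam (N + 1))
      (fun n => lam * ((N + 1 : ℕ) / m) * (1 - stayProb m (N + 1) n)) n t)
    (fun n => ?_) (fun N => agentLaw_univ_le Q μ lam t (P N)) ?_ hC
  · rw [branchingProb_eq_birthProb hm]
    refine (tendsto_killedBirthProb (b := fun N => treeIntensity m lam N)
      (d := fun N n => lam * (N / m) * (1 - stayProb m N n))
      (Eventually.of_forall fun N n => treeIntensity_nonneg m lam.coe_nonneg N n) ?_
      (tendsto_treeIntensity hm lam) (tendsto_leaveIntensity hm lam.coe_nonneg) n t.coe_nonneg).comp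
      (tendsto_add_atTop_nat 1)
    filter_upwards [eventually_ge_atTop m] with N hN n
    rw [treeIntensity_eq_mul_jumpProb]
    exact mul_le_mul_of_nonneg_left (jumpProb_le_one_sub_stayProb hm hN n) (by positivity)
  · filter_upwards [eventually_ge_atTop m] with N hN C hC
    exact treeMixture_le_agentLaw hm hQ μ lam t (by omega) (P N) hC

/-- Here the dominated mixture is the law itself, with no killing; only mass at most one and
convergence of the weights have to be checked. -/
theorem tendsto_prunedAgentLaw (hm : 2 ≤ m) (μ : Measure E) [IsProbabilityMeasure μ] (lam t : ℝ≥0)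
    {C : Set E} (hC : MeasurableSet C) :
    Tendsto (fun N => prunedAgentLaw Q μ lam t N C) atTop
      (𝓝 (extendedWildSum Q μ lam t C)) := by
  have h0 : ∀ N n, 0 ≤ treeIntensity m lam N n := treeIntensity_nonneg m lam.coe_nonneg
  refine tendsto_treeMixture Q μ (tsum_ofReal_branchingProb hm lam t)
    (pN := fun N n => birthProb (treeIntensity m lam N) n t) (fun n => ?_) (fun N => ?_)
    (Eventually.of_forall fun N C _ => le_rfl) hC
  · simp_rw [branchingProb_eq_birthProb hm, birthProb_eq_killedBirthProb]
    exact tendsto_killedBirthProb (Eventually.of_forall h0)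
      (Eventually.of_forall fun N n => le_rfl) (tendsto_treeIntensity hm lam)
      (tendsto_treeIntensity hm lam) n t.coe_nonneg
  · rw [treeMixture_univ, ENNReal.tsum_eq_iSup_nat]
    refine iSup_le fun M => ?_
    simp_rw [birthProb_eq_killedBirthProb]
    rw [← ENNReal.ofReal_sum_of_nonneg fun n _ => killedBirthProb_nonneg _ (h0 N) n t.coe_nonneg]
    exact ENNReal.ofReal_le_one.2 (sum_killedBirthProb_le_one (h0 N) (fun n => le_rfl) M t.coe_nonneg)

end

end ExtendedWild

theorem proposition3 {E : Type*} [MeasurableSpace E] (m : ℕ) [NeZero m] (hm : 2 ≤ m)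
    (Q : Kernel (Fin m → E) (Fin m → E)) [IsMarkovKernel Q]
    (hQ : ExtendedWild.IsSymmetricKernel Q)
    (μ : Measure E) [IsProbabilityMeasure μ] (lam t : ℝ≥0) :
    (∀ P : (N : ℕ) → Fin (N + 1), ∀ C : Set E, MeasurableSet C →
      Tendsto (fun N => ExtendedWild.agentLaw Q μ lam t (N + 1) (P N) C) atTop
        (𝓝 (ExtendedWild.extendedWildSum Q μ lam t C))) ∧
    (∀ C : Set E, MeasurableSet C →
      Tendsto (fun N => ExtendedWild.prunedAgentLaw Q μ lam t N C) atTop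
        (𝓝 (ExtendedWild.extendedWildSum Q μ lam t C))) :=
  ⟨fun P _ hC => ExtendedWild.tendsto_agentLaw hm hQ μ lam t P hC,
    fun _ hC => ExtendedWild.tendsto_prunedAgentLaw hm μ lam t hC⟩
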